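/- Let $(M,g)$ be a compact, connected smooth Riemannian manifold (without boundary), let $\lambda<0$ be a real number and let $\varphi:M\to\mathbb{C}$ be a smooth, non-constant function. Write $\tau$ for the Laplace--Beltrami operator, given in local coordinates by $$\tau(\varphi)=\sum_{i,j}\frac{1}{\sqrt{|g|}}\,\partial_j\bigl(g^{ij}\sqrt{|g|}\,\partial_i\varphi\bigr),$$ and $\kappa(\varphi,\varphi)=g(\nabla\varphi,\nabla\varphi)=\sum_{i,j}g^{ij}\,\partial_i\varphi\,\partial_j\varphi$, where $g$ is extended complex bilinearly. The function $\varphi$ is called a $(\lambda,\lambda)$-eigenfunction if $\tau(\varphi)=\lambda\varphi$ and $\kappa(\varphi,\varphi)=\lambda\varphi^2$ on $M$. Let $S^1\subset\mathbb{C}$ be the unit circle and let $dt^2$ be its standard metric, for which $t\mapsto e^{it}$ has unit speed. The following are equivalent: 1. $\varphi$ is a $(\lambda,\lambda)$-eigenfunction. 2. For every $x_0\in M$ one has $\varphi(x_0)\neq0$, the map $\pi(x)=\varphi(x)/|\varphi(x_0)|$ takes values in $S^1$, and $\pi:(M,g)\to\bigl(S^1,\tfrac{1}{|\lambda|}dt^2\bigr)$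 is a harmonic map and a Riemannian submersion onto $S^1$; that is, $\pi$ is smooth and surjective, its tension field vanishes, each differential $d\pi_x$ is surjective, and $d\pi_x$ is isometric on $(\ker d\pi_x)^\perp$. -/

import Mathlib

open scoped Manifold ContDiff

noncomputable section

namespace LLEigen

/-- Smooth Riemannian metrics on an `m`-dimensional smooth manifold without boundary. -/
abbrev Metric (m : ℕ) (M : Type*) [TopologicalSpace M] [ChartedSpace (EuclideanSpace ℝ (Fin m)) M]
    [IsManifold (𝓡 m) ∞ M] :=
  Bundle.ContMDiffRiemannianMetric (𝓡 m) ∞ (EuclideanSpace ℝ (Fin m))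
    (fun x : M => TangentSpace (𝓡 m) x)

section Coordinates

variable {m : ℕ}

/-- The `i`-th partial derivative of a function on `ℝ^m`. -/
def pd {F : Type*} [NormedAddCommGroup F] [NormedSpace ℝ F] (i : Fin m)
    (f : EuclideanSpace ℝ (Fin m) → F) (p : EuclideanSpace ℝ (Fin m)) : F :=
  fderiv ℝ f p (EuclideanSpace.single i 1)

variable {M : Type*} [TopologicalSpace M] [ChartedSpace (EuclideanSpace ℝ (Fin m)) M]

/-- The `i`-th coordinate vector of the chart `e`, at the point with coordinates `p`. -/
def coordVec (e : OpenPartialHomeomorph M (EuclideanSpace ℝ (Fin m))) (i : Fin m)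
    (p : EuclideanSpace ℝ (Fin m)) : TangentSpace (𝓡 m) (e.symm p) :=
  mfderiv (𝓡 m) (𝓡 m) e.symm p (EuclideanSpace.single i (1 : ℝ) : EuclideanSpace ℝ (Fin m))

variable [IsManifold (𝓡 m) ∞ M]

/-- The matrix `(g_ij)` of the metric in the chart `e`, at the point with coordinates `p`. -/
def gram (g : Metric m M) (e : OpenPartialHomeomorph M (EuclideanSpace ℝ (Fin m)))
    (p : EuclideanSpace ℝ (Fin m)) : Matrix (Fin m) (Fin m) ℝ :=
  Matrix.of fun i j => g.inner (e.symm p) (coordVec e i p) (coordVec e j p)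

/-- The Laplace-Beltrami operator `|g|^(-1/2) ∑ ∂_j (g^ij |g|^(1/2) ∂_i φ)` in the chart `e`,
at the point with coordinates `p`. -/
def coordLaplacian {F : Type*} [NormedAddCommGroup F] [NormedSpace ℝ F]
    (g : Metric m M) (e : OpenPartialHomeomorph M (EuclideanSpace ℝ (Fin m))) (φ : M → F)
    (p : EuclideanSpace ℝ (Fin m)) : F :=
  (1 / √(gram g e p).det) • ∑ i, ∑ j,
    pd j (fun q => ((gram g e q)⁻¹ i j * √(gram g e q).det) • pd i (φ ∘ e.symm) q) p

/-- The conformality operator `∑ g^ij ∂_i φ ∂_j ψ` in the chart `e`, at the point with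
coordinates `p`. -/
def coordKappa (g : Metric m M) (e : OpenPartialHomeomorph M (EuclideanSpace ℝ (Fin m)))
    (φ ψ : M → ℂ) (p : EuclideanSpace ℝ (Fin m)) : ℂ :=
  ∑ i, ∑ j, ((gram g e p)⁻¹ i j : ℂ) * pd i (φ ∘ e.symm) p * pd j (ψ ∘ e.symm) p

/-- The Christoffel symbol `Γ^γ_αβ` of the metric in the chart `e`, at the point with
coordinates `p`. -/
def christoffel (g : Metric m M) (e : OpenPartialHomeomorph M (EuclideanSpace ℝ (Fin m)))
    (γ α β : Fin m) (p : EuclideanSpace ℝ (Fin m)) : ℝ :=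
  (1 / 2) * ∑ δ, (gram g e p)⁻¹ γ δ *
    (pd α (fun q => gram g e q β δ) p + pd β (fun q => gram g e q α δ) p
      - pd δ (fun q => gram g e q α β) p)

/-- `f` is the image `τ(φ)` of `φ` under the Laplace-Beltrami operator. -/
def HasLaplacian (g : Metric m M) (φ f : M → ℂ) : Prop :=
  ∀ e ∈ IsManifold.maximalAtlas (𝓡 m) ∞ M, ∀ x ∈ e.source, coordLaplacian g e φ (e x) = f x

/-- `f` is the function `κ(φ, ψ) = g(∇φ, ∇ψ)`, where `g` is extended complex bilinearly. -/
def HasKappa (g : Metric m M) (φ ψ f : M → ℂ) : Prop :=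
  ∀ e ∈ IsManifold.maximalAtlas (𝓡 m) ∞ M, ∀ x ∈ e.source, coordKappa g e φ ψ (e x) = f x

/-- `φ` is a `(lam, mu)`-eigenfunction: `τ(φ) = lam φ` and `κ(φ, φ) = mu φ²`. -/
structure IsEigenfunction (g : Metric m M) (lam mu : ℂ) (φ : M → ℂ) : Prop where
  contMDiff : ContMDiff (𝓡 m) 𝓘(ℝ, ℂ) ∞ φ
  laplacian : HasLaplacian g φ (fun x => lam * φ x)
  kappa : HasKappa g φ φ (fun x => mu * φ x ^ 2)

variable {n : ℕ} {N : Type*} [TopologicalSpace N] [ChartedSpace (EuclideanSpace ℝ (Fin n)) N]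
  [IsManifold (𝓡 n) ∞ N]

/-- The `γ`-th component of the tension field of `π : (M, g) → (N, h)` in the charts `e` of `M`
and `f` of `N`, at the point with coordinates `p`:
`τ(π)^γ = Δ_g π^γ + ∑ g^ij Γ^γ_αβ(π) ∂_i π^α ∂_j π^β`. -/
def coordTension (g : Metric m M) (h : Metric n N)
    (e : OpenPartialHomeomorph M (EuclideanSpace ℝ (Fin m)))
    (f : OpenPartialHomeomorph N (EuclideanSpace ℝ (Fin n))) (π : M → N) (γ : Fin n)
    (p : EuclideanSpace ℝ (Fin m)) : ℝ :=
  coordLaplacian g e (fun x => f (π x) γ) p +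
    ∑ i, ∑ j, ∑ α, ∑ β, (gram g e p)⁻¹ i j * christoffel h f γ α β (f (π (e.symm p))) *
      pd i (fun q => f (π (e.symm q)) α) p * pd j (fun q => f (π (e.symm q)) β) p

/-- `π : (M, g) → (N, h)` is a harmonic map: it is smooth and its tension field vanishes. -/
structure IsHarmonicMap (g : Metric m M) (h : Metric n N) (π : M → N) : Prop where
  contMDiff : ContMDiff (𝓡 m) (𝓡 n) ∞ π
  tension_eq_zero : ∀ e ∈ IsManifold.maximalAtlas (𝓡 m) ∞ M,
    ∀ f ∈ IsManifold.maximalAtlas (𝓡 n) ∞ N, ∀ x ∈ e.source, π x ∈ f.source →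
      ∀ γ, coordTension g h e f π γ (e x) = 0

/-- `π : (M, g) → (N, h)` is a Riemannian submersion of `M` onto `N`: it is smooth and onto, its
differentials are onto, and they are isometric on the orthogonal complements of their kernels. -/
structure IsRiemannianSubmersion (g : Metric m M) (h : Metric n N) (π : M → N) : Prop where
  contMDiff : ContMDiff (𝓡 m) (𝓡 n) ∞ π
  surjective : Function.Surjective π
  surjective_mfderiv : ∀ x, Function.Surjective (mfderiv (𝓡 m) (𝓡 n) π x)
  isometric : ∀ (x : M) (v w : TangentSpace (𝓡 m) x),
    (∀ u, mfderiv (𝓡 m) (𝓡 n) π x u = 0 → g.inner x v u = 0) →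
    (∀ u, mfderiv (𝓡 m) (𝓡 n) π x u = 0 → g.inner x w u = 0) →
    h.inner (π x) (mfderiv (𝓡 m) (𝓡 n) π x v) (mfderiv (𝓡 m) (𝓡 n) π x w) = g.inner x v w

end Coordinates

section CircleMetric

/-- The differential at `z` of the inclusion of the unit circle in `ℂ`. -/
def circleIncl (z : Circle) : TangentSpace (𝓡 1) z →L[ℝ] ℂ :=
  mfderiv (𝓡 1) 𝓘(ℝ, ℂ) (fun w : Circle => (w : ℂ)) z

/-- The bilinear form of the metric `c dt²` on the circle, where `dt²` is induced from `ℂ` (so that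
`t ↦ exp (i t)` has unit speed for `dt²`). -/
def circleForm (c : ℝ) (z : Circle) :
    TangentSpace (𝓡 1) z →L[ℝ] TangentSpace (𝓡 1) z →L[ℝ] ℝ :=
  let L : EuclideanSpace ℝ (Fin 1) →L[ℝ] ℂ := circleIncl z
  (c • (innerSL ℝ : ℂ →L[ℝ] ℂ →L[ℝ] ℝ).bilinearComp L L :
    EuclideanSpace ℝ (Fin 1) →L[ℝ] EuclideanSpace ℝ (Fin 1) →L[ℝ] ℝ)

theorem circleForm_apply (c : ℝ) (z : Circle) (v w : TangentSpace (𝓡 1) z) :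
    circleForm c z v w = c * inner ℝ (circleIncl z v) (circleIncl z w) :=
  rfl

theorem circleIncl_injective (z : Circle) : Function.Injective (circleIncl z) :=
  haveI : Fact (Module.finrank ℝ ℂ = 1 + 1) := finrank_real_complex_fact'
  injective_mvfderiv_subtypeVal_sphere (E := ℂ) (n := 1) z

theorem contMDiff_circle_coe : ContMDiff (𝓡 1) 𝓘(ℝ, ℂ) ∞ (fun w : Circle => (w : ℂ)) :=
  haveI : Fact (Module.finrank ℝ ℂ = 1 + 1) := finrank_real_complex_fact'
  contMDiff_coe_sphere (E := ℂ) (n := 1)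

theorem circleForm_pos {c : ℝ} (hc : 0 < c) (z : Circle) (v : TangentSpace (𝓡 1) z)
    (hv : v ≠ 0) : 0 < circleForm c z v v := by
  rw [circleForm_apply]
  refine mul_pos hc (real_inner_self_pos.2 fun h => hv ?_)
  exact circleIncl_injective z (h.trans (map_zero _).symm)

theorem circleForm_bounded {c : ℝ} (hc : 0 < c) (z : Circle) :
    Bornology.IsVonNBounded ℝ {v : TangentSpace (𝓡 1) z | circleForm c z v v < 1} := by
  let L : EuclideanSpace ℝ (Fin 1) →L[ℝ] ℂ := circleIncl z
  obtain ⟨K, hK, hL⟩ := L.toLinearMap.exists_antilipschitzWith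
    (LinearMap.ker_eq_bot.2 (circleIncl_injective z))
  change Bornology.IsVonNBounded ℝ {v : EuclideanSpace ℝ (Fin 1) | c * inner ℝ (L v) (L v) < 1}
  refine (NormedSpace.isVonNBounded_ball ℝ (EuclideanSpace ℝ (Fin 1)) (K * √(1 / c))).subset ?_
  intro v hv
  have hv' : c * inner ℝ (L v) (L v) < 1 := hv
  rw [real_inner_self_eq_norm_sq] at hv'
  have h1 : ‖L v‖ < √(1 / c) := by
    apply Real.lt_sqrt_of_sq_lt
    rw [lt_div_iff₀ hc]
    linarith
  have h2 : ‖v‖ ≤ K * ‖L v‖ := by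
    simpa using hL.le_mul_dist v 0
  rw [mem_ball_zero_iff]
  exact h2.trans_lt (mul_lt_mul_of_pos_left h1 (by exact_mod_cast hK))

theorem circleForm_contMDiff (c : ℝ) :
    ContMDiff (𝓡 1) ((𝓡 1).prod
      𝓘(ℝ, EuclideanSpace ℝ (Fin 1) →L[ℝ] EuclideanSpace ℝ (Fin 1) →L[ℝ] ℝ)) ∞
      (fun z : Circle => Bundle.TotalSpace.mk'
        (EuclideanSpace ℝ (Fin 1) →L[ℝ] EuclideanSpace ℝ (Fin 1) →L[ℝ] ℝ) z
        (circleForm c z : TangentSpace (𝓡 1) z →L[ℝ] TangentSpace (𝓡 1) z →L[ℝ] ℝ)) := by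
  intro z₀
  rw [Bundle.contMDiffAt_section]
  have hA := (contMDiff_circle_coe z₀).mfderiv_const (m := ∞) le_rfl
  have hB : ContDiff ℝ ∞ (fun T : EuclideanSpace ℝ (Fin 1) →L[ℝ] ℂ =>
      c • (innerSL ℝ : ℂ →L[ℝ] ℂ →L[ℝ] ℝ).bilinearComp T T) := by
    refine contDiff_clm_apply_iff.2 fun v => contDiff_clm_apply_iff.2 fun w => ?_
    have h : ContDiff ℝ ∞ (fun T : EuclideanSpace ℝ (Fin 1) →L[ℝ] ℂ =>
        c * inner ℝ (T v) (T w)) :=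
      contDiff_const.mul (ContDiff.inner ℝ (by fun_prop) (by fun_prop))
    exact h
  refine (hB.contMDiff.contMDiffAt.comp z₀ hA).congr_of_eventuallyEq ?_
  filter_upwards [(chartAt (EuclideanSpace ℝ (Fin 1)) z₀).open_source.mem_nhds
    (mem_chart_source _ z₀)] with z hz
  ext v w
  have hz' : z ∈ (trivializationAt (EuclideanSpace ℝ (Fin 1) →L[ℝ] ℝ)
      (fun x : Circle => TangentSpace (𝓡 1) x →L[ℝ] Bundle.Trivial Circle ℝ x) z₀).baseSet := by
    rw [hom_trivializationAt_baseSet]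
    exact ⟨hz, Set.mem_univ _⟩
  have key : ∀ u : EuclideanSpace ℝ (Fin 1),
      (inTangentCoordinates (𝓡 1) 𝓘(ℝ, ℂ) id (fun w : Circle => (w : ℂ))
        (mfderiv (𝓡 1) 𝓘(ℝ, ℂ) fun w : Circle => (w : ℂ)) z₀ z) u =
      circleIncl z ((trivializationAt (EuclideanSpace ℝ (Fin 1))
        (fun x : Circle => TangentSpace (𝓡 1) x) z₀).symmL ℝ z u) := by
    intro u
    simp [ContinuousLinearMap.inCoordinates, inTangentCoordinates]
    rfl
  refine Eq.trans ?_ (congrArg₂ (fun a b : ℂ => c * inner ℝ a b) (key v) (key w)).symm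
  change _ = circleForm c z _ _
  rw [hom_trivializationAt_apply]
  simp only [ContinuousLinearMap.inCoordinates, ContinuousLinearMap.comp_apply]
  rw [Bundle.Trivialization.continuousLinearMapAt_apply,
    Bundle.Trivialization.coe_linearMapAt_of_mem _ hz']
  beta_reduce
  rw [hom_trivializationAt_apply]
  simp [ContinuousLinearMap.inCoordinates]

/-- The Riemannian metric `c dt²` on the unit circle. -/
def circleMetric (c : ℝ) (hc : 0 < c) : Metric 1 Circle where
  inner := circleForm c
  symm z v w := by rw [circleForm_apply, circleForm_apply, real_inner_comm]
  pos := circleForm_pos hc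
  isVonNBounded := circleForm_bounded hc
  contMDiff := circleForm_contMDiff c

end CircleMetric

end LLEigen

end

/-!
Let `φ` be a `(λ, λ)`-eigenfunction. Then `τ(|φ|²) = 2λ|φ|² + 2|∇φ|²`, which is nonnegative at the
zeros of `φ`. Elsewhere, the second equation says that `z = ∇φ/φ` satisfies `g(z, z) = λ`, that is
`|Re z|² - |Im z|² = λ`, so that `λ + |z|² = 2|Re z|² ≥ 0`. Hence `|φ|²` is subharmonic, and by
Hopf's strong maximum principle it is constant on the compact connected `M`. It remains to treat
maps `π` to the circle.

For such a `π`, the pullback `θ = π^*dt` of the angular form satisfies `dπ = iπθ`, whence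
`κ(π, π) = -|θ|²π²` and `τ(π) = (-|θ|² + i div θ)π`. So `π` is a `(λ, λ)`-eigenfunction exactly when
`div θ = 0` and `|θ|² = -λ`. The first condition is harmonicity of `π`; the second says that `dπ` is
onto and is isometric for `dt²/|λ|` on the orthogonal complement of its kernel. Such a `π` is open,
hence onto by compactness of `M`.
-/

noncomputable section

namespace LLEigen

open Filter Topology
open scoped Matrix

variable {m : ℕ}

local notation "ℝ^" n:max => EuclideanSpace ℝ (Fin n)

section PartialDerivatives

variable {F : Type*} [NormedAddCommGroup F] [NormedSpace ℝ F] {f f' : ℝ^m → F} {p : ℝ^m}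

theorem contDiffAt_pd {k n : WithTop ℕ∞} (hf : ContDiffAt ℝ n f p) (h : k + 1 ≤ n) (i : Fin m) :
    ContDiffAt ℝ k (pd i f) p :=
  (hf.fderiv_right h).clm_apply contDiffAt_const

theorem differentiableAt_pd (hf : ContDiffAt ℝ 2 f p) (i : Fin m) :
    DifferentiableAt ℝ (pd i f) p :=
  (contDiffAt_pd (k := 1) hf (by norm_num) i).differentiableAt one_ne_zero

theorem eventually_differentiableAt (hf : ContDiffAt ℝ 2 f p) :
    ∀ᶠ q in 𝓝 p, DifferentiableAt ℝ f q :=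
  (hf.eventually (by simp)).mono fun _ hq => hq.differentiableAt two_ne_zero

theorem pd_eventuallyEq (h : f =ᶠ[𝓝 p] f') (i : Fin m) : pd i f =ᶠ[𝓝 p] pd i f' := by
  filter_upwards [h.fderiv (𝕜 := ℝ)] with q hq
  simp only [pd, hq]

theorem pd_add (hf : DifferentiableAt ℝ f p) (hf' : DifferentiableAt ℝ f' p) (i : Fin m) :
    pd i (fun q => f q + f' q) p = pd i f p + pd i f' p := by
  simp only [pd, fderiv_fun_add hf hf', add_apply]

theorem pd_smul {c : ℝ^m → ℝ} (hc : DifferentiableAt ℝ c p) (hf : DifferentiableAt ℝ f p)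
    (i : Fin m) : pd i (fun q => c q • f q) p = c p • pd i f p + pd i c p • f p := by
  simp [pd, fderiv_fun_smul hc hf]

theorem pd_clm_comp {G : Type*} [NormedAddCommGroup G] [NormedSpace ℝ G] (L : F →L[ℝ] G)
    (hf : DifferentiableAt ℝ f p) (i : Fin m) : pd i (fun q => L (f q)) p = L (pd i f p) :=
  DFunLike.congr_fun (L.hasFDerivAt.comp p hf.hasFDerivAt).fderiv _

theorem pd_comp {y : ℝ^m → ℝ} {h : ℝ → F} (hy : DifferentiableAt ℝ y p)
    (hh : DifferentiableAt ℝ h (y p)) (i : Fin m) :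
    pd i (fun q => h (y q)) p = pd i y p • deriv h (y p) := by
  simp only [pd, fderiv_fun_comp p hh hy, ContinuousLinearMap.comp_apply, fderiv_eq_smul_deriv]

theorem sum_smul_single (v : Fin m → ℝ) :
    ∑ i, v i • EuclideanSpace.single i (1 : ℝ) = (WithLp.toLp 2 v : ℝ^m) := by
  ext k
  simp [Finset.sum_apply, Pi.single_apply]

theorem sum_smul_pd (f : ℝ^m → F) (p : ℝ^m) (v : Fin m → ℝ) :
    ∑ i, v i • pd i f p = fderiv ℝ f p (WithLp.toLp 2 v) := by
  simp only [← sum_smul_single, map_sum, map_smul, pd]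

end PartialDerivatives

section EllipticOperators

variable {F : Type*} [NormedAddCommGroup F] [NormedSpace ℝ F]
  {B : ℝ^m → Matrix (Fin m) (Fin m) ℝ} {ρ : ℝ^m → ℝ} {p : ℝ^m}

/-- The divergence `ρ⁻¹ ∑ ∂_j (B_ij ρ θ_i)` of an `F`-valued `1`-form `θ` with respect to the
density `ρ`, where `B` raises indices. For `B = g⁻¹` and `ρ = √|g|` this is the Riemannian
divergence of the vector field dual to `θ`. -/
def weightedDiv (B : ℝ^m → Matrix (Fin m) (Fin m) ℝ) (ρ : ℝ^m → ℝ) (θ : Fin m → ℝ^m → F)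
    (p : ℝ^m) : F :=
  (1 / ρ p) • ∑ i, ∑ j, pd j (fun q => (B q i j * ρ q) • θ i q) p

/-- The operator `f ↦ ρ⁻¹ ∑ ∂_j (B_ij ρ ∂_i f)` in divergence form. For `B = g⁻¹` and `ρ = √|g|`
this is the Laplace-Beltrami operator. -/
def ellipticOp (B : ℝ^m → Matrix (Fin m) (Fin m) ℝ) (ρ : ℝ^m → ℝ) (f : ℝ^m → F) : ℝ^m → F :=
  weightedDiv B ρ fun i => pd i f

/-- The coefficients of `ellipticOp B ρ` are `C^1` and elliptic at `p`. -/
structure IsEllipticAt (B : ℝ^m → Matrix (Fin m) (Fin m) ℝ) (ρ : ℝ^m → ℝ) (p : ℝ^m) : Prop where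
  posDef : (B p).PosDef
  pos : 0 < ρ p
  contDiffAt_coeff : ∀ i j, ContDiffAt ℝ 1 (fun q => B q i j) p
  contDiffAt_density : ContDiffAt ℝ 1 ρ p

theorem IsEllipticAt.contDiffAt_flux (hB : IsEllipticAt B ρ p) (i j : Fin m) :
    ContDiffAt ℝ 1 (fun q => B q i j * ρ q) p :=
  (hB.contDiffAt_coeff i j).mul hB.contDiffAt_density

theorem IsEllipticAt.differentiableAt_flux (hB : IsEllipticAt B ρ p) (i j : Fin m) :
    DifferentiableAt ℝ (fun q => B q i j * ρ q) p :=
  (hB.contDiffAt_flux i j).differentiableAt one_ne_zero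

theorem weightedDiv_congr {θ θ' : Fin m → ℝ^m → F} (h : ∀ i, θ i =ᶠ[𝓝 p] θ' i) :
    weightedDiv B ρ θ p = weightedDiv B ρ θ' p := by
  refine congrArg (_ • ·) (Finset.sum_congr rfl fun i _ => Finset.sum_congr rfl fun j _ => ?_)
  have hflux : (fun q => (B q i j * ρ q) • θ i q) =ᶠ[𝓝 p] fun q => (B q i j * ρ q) • θ' i q :=
    (h i).mono fun q hq => by simp only [hq]
  exact (pd_eventuallyEq hflux j).eq_of_nhds

theorem weightedDiv_add (hB : IsEllipticAt B ρ p) {θ θ' : Fin m → ℝ^m → F}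
    (hθ : ∀ i, DifferentiableAt ℝ (θ i) p) (hθ' : ∀ i, DifferentiableAt ℝ (θ' i) p) :
    weightedDiv B ρ (fun i q => θ i q + θ' i q) p =
      weightedDiv B ρ θ p + weightedDiv B ρ θ' p := by
  simp only [weightedDiv, smul_add,
    pd_add ((hB.differentiableAt_flux _ _).fun_smul (hθ _))
      ((hB.differentiableAt_flux _ _).fun_smul (hθ' _)), Finset.sum_add_distrib]

theorem weightedDiv_clm_comp {G : Type*} [NormedAddCommGroup G] [NormedSpace ℝ G] (L : F →L[ℝ] G)
    (hB : IsEllipticAt B ρ p) {θ : Fin m → ℝ^m → F} (hθ : ∀ i, DifferentiableAt ℝ (θ i) p) :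
    weightedDiv B ρ (fun i q => L (θ i q)) p = L (weightedDiv B ρ θ p) := by
  simp only [weightedDiv, ← map_smul,
    pd_clm_comp L ((hB.differentiableAt_flux _ _).fun_smul (hθ _))]
  simp only [map_smul, map_sum]

theorem weightedDiv_smul (hB : IsEllipticAt B ρ p) {θ : Fin m → ℝ^m → ℝ} {h : ℝ^m → F}
    (hθ : ∀ i, DifferentiableAt ℝ (θ i) p) (hh : DifferentiableAt ℝ h p) :
    weightedDiv B ρ (fun i q => θ i q • h q) p =
      weightedDiv B ρ θ p • h p + ∑ i, ∑ j, (B p i j * θ i p) • pd j h p := by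
  have hpd (i j : Fin m) : pd j (fun q => (B q i j * ρ q) • θ i q • h q) p =
      pd j (fun q => (B q i j * ρ q) • θ i q) p • h p +
        (B p i j * ρ p * θ i p) • pd j h p := by
    simp only [← smul_assoc]
    rw [pd_smul ((hB.differentiableAt_flux i j).fun_smul (hθ i)) hh, add_comm]
    simp only [smul_eq_mul]
  have hρ : 1 / ρ p * ρ p = 1 := one_div_mul_cancel hB.pos.ne'
  simp only [weightedDiv, hpd, Finset.sum_add_distrib, ← Finset.sum_smul]
  rw [smul_add, ← smul_assoc]
  simp only [Finset.smul_sum, ← smul_assoc]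
  refine congrArg (_ + ·) (Finset.sum_congr rfl fun i _ => Finset.sum_congr rfl fun j _ => ?_)
  congr 1
  linear_combination B p i j * θ i p * hρ

theorem ellipticOp_add (hB : IsEllipticAt B ρ p) {f f' : ℝ^m → F} (hf : ContDiffAt ℝ 2 f p)
    (hf' : ContDiffAt ℝ 2 f' p) :
    ellipticOp B ρ (fun q => f q + f' q) p = ellipticOp B ρ f p + ellipticOp B ρ f' p := by
  refine (weightedDiv_congr fun i => ?_).trans
    (weightedDiv_add hB (differentiableAt_pd hf) (differentiableAt_pd hf'))
  filter_upwards [eventually_differentiableAt hf, eventually_differentiableAt hf']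
    with q hq hq'
  exact pd_add hq hq' i

theorem ellipticOp_clm_comp {G : Type*} [NormedAddCommGroup G] [NormedSpace ℝ G] (L : F →L[ℝ] G)
    (hB : IsEllipticAt B ρ p) {f : ℝ^m → F} (hf : ContDiffAt ℝ 2 f p) :
    ellipticOp B ρ (fun q => L (f q)) p = L (ellipticOp B ρ f p) := by
  refine (weightedDiv_congr fun i => ?_).trans (weightedDiv_clm_comp L hB (differentiableAt_pd hf))
  filter_upwards [eventually_differentiableAt hf] with q hq
  exact pd_clm_comp L hq i

theorem sum_mul_mul_eq_dotProduct_mulVec {ι R : Type*} [Fintype ι] [CommSemiring R]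
    (A : Matrix ι ι R) (x y : ι → R) : ∑ i, ∑ j, A i j * x i * y j = x ⬝ᵥ A *ᵥ y := by
  simp only [dotProduct, Matrix.mulVec, Finset.mul_sum, mul_assoc, mul_left_comm]

theorem ellipticOp_comp (hB : IsEllipticAt B ρ p) {y : ℝ^m → ℝ} {h : ℝ → F}
    (hy : ContDiffAt ℝ 2 y p) (hh : ContDiffAt ℝ 2 h (y p)) :
    ellipticOp B ρ (fun q => h (y q)) p = ellipticOp B ρ y p • deriv h (y p) +
      ((pd · y p) ⬝ᵥ B p *ᵥ (pd · y p)) • deriv (deriv h) (y p) := by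
  have hpd (i : Fin m) : pd i (fun q => h (y q)) =ᶠ[𝓝 p] fun q => pd i y q • deriv h (y q) := by
    filter_upwards [eventually_differentiableAt hy,
      hy.continuousAt.eventually (hh.eventually (by simp))] with q hyq hhq
    exact pd_comp hyq (hhq.differentiableAt two_ne_zero) i
  have hy₁ : DifferentiableAt ℝ y p := hy.differentiableAt two_ne_zero
  have hh' : DifferentiableAt ℝ (deriv h) (y p) :=
    ((hh.fderiv_right (m := 1) (by norm_num)).clm_apply
      (contDiffAt_const (c := (1 : ℝ)))).differentiableAt one_ne_zero
  refine (weightedDiv_congr hpd).trans ?_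
  rw [weightedDiv_smul hB (differentiableAt_pd hy) (hh'.fun_comp' p hy₁),
    ← sum_mul_mul_eq_dotProduct_mulVec]
  simp only [pd_comp hy₁ hh', smul_smul, ← Finset.sum_smul, ellipticOp]

theorem ellipticOp_sq (hB : IsEllipticAt B ρ p) {u : ℝ^m → ℝ} (hu : ContDiffAt ℝ 2 u p) :
    ellipticOp B ρ (fun q => u q ^ 2) p =
      2 * u p * ellipticOp B ρ u p + 2 * ((pd · u p) ⬝ᵥ B p *ᵥ (pd · u p)) := by
  have hderiv : deriv (fun t : ℝ => t ^ 2) = fun t => 2 * t := by ext t; simp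
  rw [ellipticOp_comp hB (h := (· ^ 2)) hu (by fun_prop), hderiv, deriv_const_mul_field, deriv_id'']
  simp only [smul_eq_mul]
  ring

theorem continuousAt_ellipticOp (hB : IsEllipticAt B ρ p) {f : ℝ^m → F} (hf : ContDiffAt ℝ 2 f p) :
    ContinuousAt (ellipticOp B ρ f) p := by
  refine ContinuousAt.smul (continuousAt_const.div hB.contDiffAt_density.continuousAt hB.pos.ne') ?_
  refine tendsto_finsetSum _ fun i _ => tendsto_finsetSum _ fun j _ => ?_
  exact (contDiffAt_pd (k := 0) ((hB.contDiffAt_flux i j).smul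
    (contDiffAt_pd (k := 1) hf (by norm_num) i)) (by norm_num) j).continuousAt

end EllipticOperators

section MaximumPrinciple

variable {B : ℝ^m → Matrix (Fin m) (Fin m) ℝ} {ρ : ℝ^m → ℝ} {p : ℝ^m}

theorem deriv_deriv_nonpos_of_isLocalMax {h : ℝ → ℝ} {t : ℝ} (hh : ContinuousAt h t)
    (hmax : IsLocalMax h t) : deriv (deriv h) t ≤ 0 := by
  by_contra! hpos
  have hmin : IsLocalMin h t := isLocalMin_of_deriv_deriv_pos hpos hmax.deriv_eq_zero hh
  have hconst : h =ᶠ[𝓝 t] fun _ => h t := by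
    filter_upwards [hmax, hmin] with s hle hge using le_antisymm hle hge
  have hzero : deriv (deriv h) t = 0 := by
    rw [hconst.deriv.deriv_eq]
    simp only [deriv_const', deriv_const]
  exact hpos.ne' hzero

theorem fderiv_fderiv_nonpos_of_isLocalMax {E : Type*} [NormedAddCommGroup E] [NormedSpace ℝ E]
    {w : E → ℝ} {x : E} (hw : ContDiffAt ℝ 2 w x) (hmax : IsLocalMax w x) (v : E) :
    fderiv ℝ (fun q => fderiv ℝ w q v) x v ≤ 0 := by
  let l : ℝ → E := fun t => x + t • v
  have hl (t : ℝ) : HasDerivAt l v t := by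
    have h := ((hasDerivAt_id t).smul_const v).const_add x
    rwa [one_smul] at h
  have hl₀ : l 0 = x := by simp [l]
  have hlx : Tendsto l (𝓝 0) (𝓝 x) := hl₀ ▸ (hl 0).continuousAt.tendsto
  have hderiv : deriv (w ∘ l) =ᶠ[𝓝 0] fun t => fderiv ℝ w (l t) v := by
    filter_upwards [hlx.eventually (hw.eventually (by simp))] with t ht
    exact ((ht.differentiableAt two_ne_zero).hasFDerivAt.comp_hasDerivAt t (hl t)).deriv
  have hdiff : DifferentiableAt ℝ (fun q => fderiv ℝ w q v) (l 0) :=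
    hl₀ ▸ ((hw.fderiv_right (m := 1) (by norm_num)).clm_apply contDiffAt_const).differentiableAt
      one_ne_zero
  have hderiv₂ : deriv (deriv (w ∘ l)) 0 = fderiv ℝ (fun q => fderiv ℝ w q v) x v := by
    rw [hderiv.deriv_eq, ← hl₀]
    exact (hdiff.hasFDerivAt.comp_hasDerivAt 0 (hl 0)).deriv
  rw [← hderiv₂]
  refine deriv_deriv_nonpos_of_isLocalMax ?_ ?_
  · exact ContinuousAt.comp (hl₀ ▸ hw.continuousAt) (hl 0).continuousAt
  · simpa only [IsLocalMax, IsMaxFilter, Function.comp_apply, hl₀] using hlx.eventually hmax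

theorem dotProduct_hessian_mulVec (w : ℝ^m → ℝ) (hw : ContDiffAt ℝ 2 w p) (v : Fin m → ℝ) :
    v ⬝ᵥ Matrix.of (fun i j => pd j (pd i w) p) *ᵥ v =
      fderiv ℝ (fun q => fderiv ℝ w q (WithLp.toLp 2 v)) p (WithLp.toLp 2 v) := by
  simp only [← sum_smul_pd w, ← sum_mul_mul_eq_dotProduct_mulVec, Matrix.of_apply]
  rw [fderiv_fun_sum fun i _ => (differentiableAt_pd hw i).fun_const_smul (v i)]
  rw [sum_apply]
  refine Finset.sum_congr rfl fun i _ => ?_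
  rw [fderiv_fun_const_smul (differentiableAt_pd hw i), smul_apply, ← sum_smul_pd (pd i w),
    smul_eq_mul, Finset.mul_sum]
  exact Finset.sum_congr rfl fun j _ => by rw [smul_eq_mul]; ring

theorem sum_mul_nonpos_of_posSemidef {ι : Type*} [Fintype ι] {A H : Matrix ι ι ℝ}
    (hA : A.PosSemidef) (hH : ∀ v, v ⬝ᵥ H *ᵥ v ≤ 0) : ∑ i, ∑ j, A i j * H i j ≤ 0 := by
  obtain ⟨C, rfl⟩ : ∃ C : Matrix ι ι ℝ, A = C.conjTranspose * C := by
    classical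
    open scoped MatrixOrder in
    exact CStarAlgebra.nonneg_iff_eq_star_mul_self.1 hA.nonneg
  calc ∑ i, ∑ j, (C.conjTranspose * C) i j * H i j
      = ∑ i, ∑ j, ∑ k, H i j * C k i * C k j := by
        simp only [Matrix.mul_apply, Matrix.conjTranspose_apply, star_trivial, Finset.sum_mul]
        exact Finset.sum_congr rfl fun i _ => Finset.sum_congr rfl fun j _ =>
          Finset.sum_congr rfl fun k _ => by ring
    _ = ∑ i, ∑ k, ∑ j, H i j * C k i * C k j := Finset.sum_congr rfl fun i _ => Finset.sum_comm
    _ = ∑ k, C k ⬝ᵥ H *ᵥ C k := by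
        rw [Finset.sum_comm]
        simp only [sum_mul_mul_eq_dotProduct_mulVec]
    _ ≤ 0 := Finset.sum_nonpos fun k _ => hH (C k)

theorem ellipticOp_nonpos_of_isLocalMax (hB : IsEllipticAt B ρ p) {w : ℝ^m → ℝ}
    (hw : ContDiffAt ℝ 2 w p) (hmax : IsLocalMax w p) : ellipticOp B ρ w p ≤ 0 := by
  have hpd (i : Fin m) : pd i w p = 0 := by simp only [pd, hmax.fderiv_eq_zero, zero_apply]
  have hflux (i j : Fin m) : pd j (fun q => (B q i j * ρ q) • pd i w q) p =
      ρ p * (B p i j * pd j (pd i w) p) := by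
    rw [pd_smul (hB.differentiableAt_flux i j) (differentiableAt_pd hw i), hpd, smul_zero, add_zero,
      smul_eq_mul]
    ring
  simp only [ellipticOp, weightedDiv, hflux, ← Finset.mul_sum]
  rw [smul_eq_mul, ← mul_assoc, one_div_mul_cancel hB.pos.ne', one_mul]
  refine sum_mul_nonpos_of_posSemidef (H := Matrix.of fun i j => pd j (pd i w) p)
    hB.posDef.posSemidef fun v => ?_
  rw [dotProduct_hessian_mulVec w hw v]
  exact fderiv_fderiv_nonpos_of_isLocalMax hw hmax _

theorem pd_norm_sub_sq (x y : ℝ^m) (i : Fin m) :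
    pd i (fun q => ‖q - y‖ ^ 2) x = 2 * (x - y) i := by
  have h : HasFDerivAt (fun q => ‖q - y‖ ^ 2) _ x := ((hasFDerivAt_id x).sub_const y).norm_sq
  rw [pd, h.fderiv]
  simp [two_mul, EuclideanSpace.inner_single_right]

/-- Hopf's barrier `exp (-α |q - y|²) - exp (-α |x - y|²)`, for a large `α`. -/
theorem exists_barrier {x y : ℝ^m} (hxy : x ≠ y) (hB : IsEllipticAt B ρ x) :
    ∃ w : ℝ^m → ℝ, ContDiff ℝ 2 w ∧ w x = 0 ∧ (∀ q, dist x y < dist q y → w q < 0) ∧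
      0 < ellipticOp B ρ w x := by
  let ψ : ℝ^m → ℝ := fun q => ‖q - y‖ ^ 2
  have hψ : ContDiff ℝ 2 ψ := (contDiff_id.sub contDiff_const).norm_sq ℝ
  have hgrad : (pd · ψ x) ≠ 0 := by
    intro h
    refine hxy (sub_eq_zero.1 (PiLp.ext fun i => ?_))
    have hi := congrFun h i
    simp only [ψ, pd_norm_sub_sq] at hi
    simpa using hi
  have hpos : 0 < (pd · ψ x) ⬝ᵥ B x *ᵥ (pd · ψ x) := hB.posDef.dotProduct_mulVec_pos hgrad
  obtain ⟨α, hα⟩ := exists_gt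
    (max 0 (ellipticOp B ρ ψ x / ((pd · ψ x) ⬝ᵥ B x *ᵥ (pd · ψ x))))
  obtain ⟨hα₀, hα₁⟩ := max_lt_iff.1 hα
  rw [div_lt_iff₀ hpos] at hα₁
  let h : ℝ → ℝ := fun s => Real.exp (-α * s) - Real.exp (-α * ψ x)
  have hexp (s : ℝ) : HasDerivAt (fun s => Real.exp (-α * s)) (-α * Real.exp (-α * s)) s := by
    simpa [mul_comm] using ((hasDerivAt_id s).const_mul (-α)).exp
  have hderiv : deriv h = fun s => -α * Real.exp (-α * s) :=
    funext fun s => ((hexp s).sub_const _).deriv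
  have hh : ContDiff ℝ 2 h := by fun_prop
  refine ⟨fun q => h (ψ q), hh.comp hψ, sub_self _, fun q hq => ?_, ?_⟩
  · rw [dist_eq_norm, dist_eq_norm] at hq
    have : ψ x < ψ q := pow_lt_pow_left₀ hq (norm_nonneg _) two_ne_zero
    exact sub_neg.2 (Real.exp_lt_exp.2 (by nlinarith))
  · rw [ellipticOp_comp hB hψ.contDiffAt hh.contDiffAt, hderiv, ((hexp (ψ x)).const_mul (-α)).deriv]
    have := mul_pos (mul_pos hα₀ (Real.exp_pos (-α * ψ x))) (sub_pos.2 hα₁)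
    simp only [smul_eq_mul]
    linarith

theorem exists_pos_forall_add_mul_lt {X : Type*} [TopologicalSpace X] {K : Set X} (hK : IsCompact K)
    {u w : X → ℝ} (hu : ContinuousOn u K) (hw : ContinuousOn w K) {b : ℝ} (hub : ∀ q ∈ K, u q < b) :
    ∃ ε > 0, ∀ q ∈ K, u q + ε * w q < b := by
  rcases K.eq_empty_or_nonempty with rfl | hne
  · exact ⟨1, one_pos, by simp⟩
  obtain ⟨k, hk, hkmax⟩ := hK.exists_isMaxOn hne hu
  obtain ⟨C, hC⟩ := hK.exists_bound_of_continuousOn hw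
  have hC₀ : 0 ≤ C := (norm_nonneg _).trans (hC k hk)
  have hgap : 0 < b - u k := sub_pos.2 (hub k hk)
  refine ⟨(b - u k) / (C + 1), by positivity, fun q hq => ?_⟩
  calc u q + (b - u k) / (C + 1) * w q
      ≤ u k + (b - u k) / (C + 1) * C := by
        gcongr
        · exact hkmax hq
        · exact (le_abs_self _).trans (hC q hq)
    _ < u k + (b - u k) / (C + 1) * (C + 1) := by gcongr; linarith
    _ = b := by field_simp; ring

/-- The core of Hopf's lemma: the perturbation of `u` by a small multiple of the barrier would have
a local maximum near `x`, where `ellipticOp` is positive. -/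
theorem false_of_isLocalMax_of_touching_ball {u : ℝ^m → ℝ} {x y : ℝ^m} (hxy : x ≠ y)
    (hB : ∀ᶠ q in 𝓝 x, IsEllipticAt B ρ q) (hu : ∀ᶠ q in 𝓝 x, ContDiffAt ℝ 2 u q)
    (hLu : ∀ᶠ q in 𝓝 x, 0 ≤ ellipticOp B ρ u q) (hmax : IsLocalMax u x)
    (htouch : ∀ᶠ q in 𝓝 x, dist q y ≤ dist x y → u q = u x → q = x) : False := by
  obtain ⟨w, hw, hwx, hw_neg, hLwx⟩ := exists_barrier hxy hB.self_of_nhds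
  have hLw : ∀ᶠ q in 𝓝 x, 0 < ellipticOp B ρ w q :=
    (continuousAt_ellipticOp hB.self_of_nhds hw.contDiffAt).eventually_const_lt hLwx
  obtain ⟨r, hr, hall⟩ := Metric.nhds_basis_closedBall.eventually_iff.1
    (hB.and (hu.and (hLu.and (hLw.and (hmax.and htouch)))))
  have hu_cont : ContinuousOn u (Metric.closedBall x r) := fun q hq =>
    (hall hq).2.1.continuousAt.continuousWithinAt
  obtain ⟨ε, hε, hK⟩ : ∃ ε > 0, ∀ q ∈ Metric.sphere x r ∩ Metric.closedBall y (dist x y),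
      u q + ε * w q < u x := by
    refine exists_pos_forall_add_mul_lt
      ((isCompact_sphere x r).inter_right Metric.isClosed_closedBall)
      (hu_cont.mono fun q hq => Metric.sphere_subset_closedBall hq.1)
      hw.continuous.continuousOn fun q hq => ?_
    obtain ⟨-, -, -, -, hle, hq_eq⟩ := hall (Metric.sphere_subset_closedBall hq.1)
    exact hle.lt_of_ne fun h => Metric.ne_of_mem_sphere hq.1 hr.ne' (hq_eq hq.2 h)
  have hsphere : ∀ q ∈ Metric.closedBall x r \ Metric.ball x r,
      u q + ε * w q < u x + ε * w x := fun q hq => by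
    rw [Metric.closedBall_sdiff_ball] at hq
    rw [hwx, mul_zero, add_zero]
    rcases le_or_gt (dist q y) (dist x y) with hqy | hqy
    · exact hK q ⟨hq, hqy⟩
    · have hle := (hall (Metric.sphere_subset_closedBall hq)).2.2.2.2.1
      linarith [mul_neg_of_pos_of_neg hε (hw_neg q hqy)]
  have hεw : ContDiff ℝ 2 fun q => ε * w q := contDiff_const.mul hw
  obtain ⟨z, hz, hz_max⟩ := (isCompact_closedBall x r).exists_isLocalMax_mem_open
    Metric.ball_subset_closedBall (hu_cont.add hεw.continuous.continuousOn)
    (Metric.mem_closedBall_self hr.le) hsphere Metric.isOpen_ball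
  obtain ⟨hBz, huz, hLuz, hLwz, -⟩ := hall (Metric.ball_subset_closedBall hz)
  have hLz := ellipticOp_nonpos_of_isLocalMax hBz (huz.add hεw.contDiffAt) hz_max
  have hLεw : ellipticOp B ρ (fun q => ε * w q) z = ε * ellipticOp B ρ w z :=
    ellipticOp_clm_comp (ε • ContinuousLinearMap.id ℝ ℝ) hBz hw.contDiffAt
  rw [ellipticOp_add hBz huz hεw.contDiffAt, hLεw] at hLz
  linarith [mul_pos hε hLwz]

theorem norm_lt_of_norm_sub_half_le {V : Type*} [NormedAddCommGroup V] [InnerProductSpace ℝ V]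
    {z a : V} (h : ‖z - (1 / 2 : ℝ) • a‖ ≤ ‖(1 / 2 : ℝ) • a‖) (hza : z ≠ a) : ‖z‖ < ‖a‖ := by
  have h1 := pow_le_pow_left₀ (norm_nonneg _) h 2
  rw [norm_sub_sq_real, inner_smul_right] at h1
  have h2 : 0 < ‖z - a‖ ^ 2 := by
    have := norm_pos_iff.2 (sub_ne_zero.2 hza)
    positivity
  rw [norm_sub_sq_real] at h2
  refine lt_of_pow_lt_pow_left₀ 2 (norm_nonneg _) ?_
  linarith

/-- A nearest point `x` of `C` to `y₀`, and the midpoint `y` of `x` and `y₀`: the ball with diameter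
`[x, y₀]` meets the boundary of the ball around `y₀` in `x` only. -/
theorem exists_touching_ball {V : Type*} [NormedAddCommGroup V] [InnerProductSpace ℝ V]
    [ProperSpace V] {C : Set V} (hC : IsClosed C) {p y₀ : V} (hp : p ∈ C) (hy₀ : y₀ ∉ C) :
    ∃ x ∈ C, ∃ y ≠ x, dist x p ≤ 2 * dist y₀ p ∧ ∀ q ∈ C, dist q y ≤ dist x y → q = x := by
  obtain ⟨x, hx, hx_dist⟩ := hC.exists_infDist_eq_dist ⟨p, hp⟩ y₀
  have hnear (q : V) (hq : q ∈ C) : dist y₀ x ≤ dist y₀ q :=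
    hx_dist.symm.trans_le (Metric.infDist_le_dist_of_mem hq)
  have hne : x ≠ y₀ := fun h => hy₀ (h ▸ hx)
  have hsub : x - (y₀ + (1 / 2 : ℝ) • (x - y₀)) = (1 / 2 : ℝ) • (x - y₀) := by module
  refine ⟨x, hx, y₀ + (1 / 2 : ℝ) • (x - y₀), fun h => ?_, ?_, fun q hq hqy => ?_⟩
  · rw [h, sub_self, eq_comm, smul_eq_zero, sub_eq_zero] at hsub
    exact hsub.elim (by norm_num) hne
  · linarith [hnear p hp, dist_triangle_left x p y₀]
  · by_contra hqx
    rw [dist_eq_norm, dist_eq_norm, hsub, ← sub_sub] at hqy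
    have hlt := norm_lt_of_norm_sub_half_le hqy fun h => hqx (sub_left_injective h)
    rw [← dist_eq_norm, ← dist_eq_norm, dist_comm q, dist_comm x] at hlt
    exact hlt.not_ge (hnear q hq)

/-- The strong maximum principle, in its local form. -/
theorem eventually_eq_of_isLocalMax {u : ℝ^m → ℝ} (hB : ∀ᶠ q in 𝓝 p, IsEllipticAt B ρ q)
    (hu : ∀ᶠ q in 𝓝 p, ContDiffAt ℝ 2 u q) (hLu : ∀ᶠ q in 𝓝 p, 0 ≤ ellipticOp B ρ u q)
    (hmax : IsLocalMax u p) : ∀ᶠ q in 𝓝 p, u q = u p := by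
  obtain ⟨r, hr, hall⟩ := Metric.nhds_basis_ball.eventually_iff.1
    (hB.and (hu.and (hLu.and hmax)))
  obtain ⟨δ, hδ, hδr⟩ : ∃ δ > 0, 2 * δ < r := ⟨r / 3, by positivity, by linarith⟩
  have hsub : Metric.closedBall p (2 * δ) ⊆ Metric.ball p r := Metric.closedBall_subset_ball hδr
  let C : Set (ℝ^m) := Metric.closedBall p (2 * δ) ∩ u ⁻¹' {u p}
  have hC : IsClosed C := ContinuousOn.preimage_isClosed_of_isClosed
    (fun q hq => (hall (hsub hq)).2.1.continuousAt.continuousWithinAt)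
    Metric.isClosed_closedBall isClosed_singleton
  have hpC : p ∈ C := ⟨Metric.mem_closedBall_self (by positivity), rfl⟩
  refine Metric.eventually_nhds_iff_ball.2 ⟨δ, hδ, fun y₀ hy₀ => ?_⟩
  suffices y₀ ∈ C from this.2
  by_contra hy₀C
  obtain ⟨x, hx, y, hyx, hxp, htouch⟩ := exists_touching_ball hC hpC hy₀C
  have hux : u x = u p := hx.2
  have hxδ : x ∈ Metric.ball p (2 * δ) := by
    rw [Metric.mem_ball] at hy₀ ⊢
    linarith
  have hnhds : ∀ᶠ q in 𝓝 x, q ∈ Metric.ball p (2 * δ) := Metric.isOpen_ball.mem_nhds hxδ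
  have hev := hnhds.mono fun q hq => hall (hsub (Metric.ball_subset_closedBall hq))
  refine false_of_isLocalMax_of_touching_ball hyx.symm (hev.mono fun q h => h.1)
    (hev.mono fun q h => h.2.1) (hev.mono fun q h => h.2.2.1)
    (hev.mono fun q h => h.2.2.2.trans_eq hux.symm) (hnhds.mono fun q hq hqy huq => ?_)
  exact htouch q ⟨Metric.ball_subset_closedBall hq, huq.trans hux⟩ hqy

end MaximumPrinciple

section Subharmonic

open scoped ComplexConjugate

theorem re_sum_mul_mul {ι : Type*} [Fintype ι] (A : Matrix ι ι ℝ) (z : ι → ℂ) :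
    (∑ i, ∑ j, (A i j : ℂ) * z i * z j).re =
      (fun i => (z i).re) ⬝ᵥ A *ᵥ (fun i => (z i).re) -
        (fun i => (z i).im) ⬝ᵥ A *ᵥ (fun i => (z i).im) := by
  simp only [← sum_mul_mul_eq_dotProduct_mulVec, ← Finset.sum_sub_distrib, Complex.re_sum,
    Complex.mul_re, Complex.mul_im, Complex.ofReal_re, Complex.ofReal_im, zero_mul, sub_zero,
    add_zero]

theorem re_sum_mul_mul_conj {ι : Type*} [Fintype ι] (A : Matrix ι ι ℝ) (z : ι → ℂ) :
    (∑ i, ∑ j, (A i j : ℂ) * z i * conj (z j)).re =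
      (fun i => (z i).re) ⬝ᵥ A *ᵥ (fun i => (z i).re) +
        (fun i => (z i).im) ⬝ᵥ A *ᵥ (fun i => (z i).im) := by
  simp only [← sum_mul_mul_eq_dotProduct_mulVec, ← Finset.sum_add_distrib, Complex.re_sum,
    Complex.mul_re, Complex.mul_im, Complex.ofReal_re, Complex.ofReal_im, zero_mul, sub_zero,
    add_zero, Complex.conj_re, Complex.conj_im, mul_neg, sub_neg_eq_add]

theorem re_sum_add_re_sum_conj_nonneg {ι : Type*} [Fintype ι] {A : Matrix ι ι ℝ}
    (hA : A.PosSemidef) (z : ι → ℂ) :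
    0 ≤ (∑ i, ∑ j, (A i j : ℂ) * z i * z j).re + (∑ i, ∑ j, (A i j : ℂ) * z i * conj (z j)).re := by
  rw [re_sum_mul_mul, re_sum_mul_mul_conj]
  have := hA.dotProduct_mulVec_nonneg fun i => (z i).re
  rw [star_trivial] at this
  linarith

theorem mul_norm_sq_add_re_sum_conj_nonneg {ι : Type*} [Fintype ι] {A : Matrix ι ι ℝ}
    (hA : A.PosSemidef) {z : ι → ℂ} {w : ℂ} {lam : ℝ}
    (h : ∑ i, ∑ j, (A i j : ℂ) * z i * z j = lam * w ^ 2) :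
    0 ≤ lam * ‖w‖ ^ 2 + (∑ i, ∑ j, (A i j : ℂ) * z i * conj (z j)).re := by
  rcases eq_or_ne w 0 with rfl | hw
  · simpa [h] using re_sum_add_re_sum_conj_nonneg hA z
  -- After division by `w`, the right-hand side of `h` is the real number `lam`.
  have hdiv : ∑ i, ∑ j, (A i j : ℂ) * (z i / w) * (z j / w) = lam := by
    rw [← mul_div_cancel_right₀ (lam : ℂ) (pow_ne_zero 2 hw), ← h]
    simp only [Finset.sum_div]
    exact Finset.sum_congr rfl fun i _ => Finset.sum_congr rfl fun j _ => by ring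
  have hconj : ∑ i, ∑ j, (A i j : ℂ) * z i * conj (z j) =
      (‖w‖ ^ 2 : ℝ) * ∑ i, ∑ j, (A i j : ℂ) * (z i / w) * conj (z j / w) := by
    have hw' : conj w ≠ 0 := (map_ne_zero _).2 hw
    rw [Complex.ofReal_pow, ← Complex.mul_conj']
    simp only [Finset.mul_sum, map_div₀]
    refine Finset.sum_congr rfl fun i _ => Finset.sum_congr rfl fun j _ => ?_
    field_simp
  have hnonneg := re_sum_add_re_sum_conj_nonneg hA fun i => z i / w
  rw [hdiv, Complex.ofReal_re] at hnonneg
  rw [hconj, Complex.re_ofReal_mul, mul_comm lam, ← mul_add]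
  exact mul_nonneg (sq_nonneg _) hnonneg

variable {B : ℝ^m → Matrix (Fin m) (Fin m) ℝ} {ρ : ℝ^m → ℝ} {p : ℝ^m}

theorem ellipticOp_norm_sq (hB : IsEllipticAt B ρ p) {P : ℝ^m → ℂ} (hP : ContDiffAt ℝ 2 P p) :
    ellipticOp B ρ (fun q => ‖P q‖ ^ 2) p = 2 * (conj (P p) * ellipticOp B ρ P p).re +
      2 * (∑ i, ∑ j, (B p i j : ℂ) * pd i P p * conj (pd j P p)).re := by
  have hP₁ : DifferentiableAt ℝ P p := hP.differentiableAt two_ne_zero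
  have hre (i : Fin m) : pd i (fun q => (P q).re) p = (pd i P p).re :=
    pd_clm_comp Complex.reCLM hP₁ i
  have him (i : Fin m) : pd i (fun q => (P q).im) p = (pd i P p).im :=
    pd_clm_comp Complex.imCLM hP₁ i
  have hLre : ellipticOp B ρ (fun q => (P q).re) p = (ellipticOp B ρ P p).re :=
    ellipticOp_clm_comp Complex.reCLM hB hP
  have hLim : ellipticOp B ρ (fun q => (P q).im) p = (ellipticOp B ρ P p).im :=
    ellipticOp_clm_comp Complex.imCLM hB hP
  have hu : ContDiffAt ℝ 2 (fun q => (P q).re) p := Complex.reCLM.contDiff.contDiffAt.comp p hP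
  have hv : ContDiffAt ℝ 2 (fun q => (P q).im) p := Complex.imCLM.contDiff.contDiffAt.comp p hP
  have hsplit : (fun q => ‖P q‖ ^ 2) = fun q => (P q).re ^ 2 + (P q).im ^ 2 :=
    funext fun q => by rw [Complex.sq_norm, Complex.normSq_apply, sq, sq]
  rw [hsplit, ellipticOp_add hB (hu.pow 2) (hv.pow 2), ellipticOp_sq hB hu, ellipticOp_sq hB hv,
    hLre, hLim, re_sum_mul_mul_conj, Complex.mul_re, Complex.conj_re, Complex.conj_im]
  simp only [hre, him]
  ring

theorem ellipticOp_norm_sq_nonneg (hB : IsEllipticAt B ρ p) {P : ℝ^m → ℂ}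
    (hP : ContDiffAt ℝ 2 P p) {lam : ℝ} (hL : ellipticOp B ρ P p = lam * P p)
    (hK : ∑ i, ∑ j, (B p i j : ℂ) * pd i P p * pd j P p = lam * P p ^ 2) :
    0 ≤ ellipticOp B ρ (fun q => ‖P q‖ ^ 2) p := by
  have hre : (conj (P p) * (lam * P p)).re = lam * ‖P p‖ ^ 2 := by
    rw [mul_left_comm, Complex.conj_mul', ← Complex.ofReal_pow, ← Complex.ofReal_mul,
      Complex.ofReal_re]
  rw [ellipticOp_norm_sq hB hP, hL, hre, ← mul_add]
  exact mul_nonneg zero_le_two (mul_norm_sq_add_re_sum_conj_nonneg hB.posDef.posSemidef hK)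

end Subharmonic

theorem contDiffAt_det {E ι : Type*} [NormedAddCommGroup E] [NormedSpace ℝ E] [Fintype ι]
    [DecidableEq ι] {A : E → Matrix ι ι ℝ} {p : E} {n : WithTop ℕ∞}
    (hA : ∀ i j, ContDiffAt ℝ n (fun q => A q i j) p) : ContDiffAt ℝ n (fun q => (A q).det) p := by
  simp only [Matrix.det_apply]
  exact ContDiffAt.sum fun σ _ => (contDiffAt_prod fun i _ => hA (σ i) i).const_smul _

theorem contDiffAt_matrix_inv {E ι : Type*} [NormedAddCommGroup E] [NormedSpace ℝ E] [Fintype ι]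
    [DecidableEq ι] {A : E → Matrix ι ι ℝ} {p : E} {n : WithTop ℕ∞}
    (hA : ∀ i j, ContDiffAt ℝ n (fun q => A q i j) p) (hdet : (A p).det ≠ 0) (i j : ι) :
    ContDiffAt ℝ n (fun q => (A q)⁻¹ i j) p := by
  simp only [Matrix.inv_def, Ring.inverse_eq_inv', Matrix.smul_apply, smul_eq_mul,
    Matrix.adjugate_apply]
  refine ((contDiffAt_det hA).inv hdet).mul (contDiffAt_det fun k l => ?_)
  by_cases hk : k = j
  · subst hk
    simpa using contDiffAt_const
  · simpa [Matrix.updateRow_apply, hk] using hA k l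

section Charts

variable {M : Type*} [TopologicalSpace M] [ChartedSpace (ℝ^m) M]
  {e : OpenPartialHomeomorph M (ℝ^m)} {p : ℝ^m}

theorem mdifferentiable_chart (he : e ∈ IsManifold.maximalAtlas (𝓡 m) ∞ M) :
    e.MDifferentiable (𝓡 m) (𝓡 m) :=
  ⟨(contMDiffOn_of_mem_maximalAtlas he).mdifferentiableOn (by simp),
    (contMDiffOn_symm_of_mem_maximalAtlas he).mdifferentiableOn (by simp)⟩

theorem mdifferentiableAt_chart_symm (he : e ∈ IsManifold.maximalAtlas (𝓡 m) ∞ M)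
    (hp : p ∈ e.target) : MDifferentiableAt (𝓡 m) (𝓡 m) e.symm p :=
  (mdifferentiable_chart he).mdifferentiableAt_symm hp

theorem mfderiv_chart_symm_bijective (he : e ∈ IsManifold.maximalAtlas (𝓡 m) ∞ M)
    (hp : p ∈ e.target) : Function.Bijective (mfderiv (𝓡 m) (𝓡 m) e.symm p) :=
  (mdifferentiable_chart he).symm.mfderiv_bijective hp

theorem sum_smul_coordVec (e : OpenPartialHomeomorph M (ℝ^m)) (p : ℝ^m) (v : Fin m → ℝ) :
    ∑ i, v i • coordVec e i p =
      mfderiv (𝓡 m) (𝓡 m) e.symm p (WithLp.toLp 2 v : ℝ^m) := by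
  rw [← sum_smul_single]
  refine ((map_sum (mfderiv (𝓡 m) (𝓡 m) e.symm p) _ _).trans ?_).symm
  exact Finset.sum_congr rfl fun i _ => map_smul (mfderiv (𝓡 m) (𝓡 m) e.symm p) _ _

theorem exists_eq_sum_coordVec (he : e ∈ IsManifold.maximalAtlas (𝓡 m) ∞ M) (hp : p ∈ e.target)
    (v : TangentSpace (𝓡 m) (e.symm p)) : ∃ a : Fin m → ℝ, v = ∑ i, a i • coordVec e i p := by
  obtain ⟨w, rfl⟩ := (mfderiv_chart_symm_bijective he hp).2 v
  exact ⟨(w : ℝ^m).ofLp, (sum_smul_coordVec e p _).symm⟩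

theorem contMDiffAt_coordVec [IsManifold (𝓡 m) ∞ M] (he : e ∈ IsManifold.maximalAtlas (𝓡 m) ∞ M)
    (hp : p ∈ e.target) (i : Fin m) :
    ContMDiffAt (𝓡 m) ((𝓡 m).prod (𝓡 m)) ∞
      (fun q => (Bundle.TotalSpace.mk' (ℝ^m) (e.symm q) (coordVec e i q) : TangentBundle (𝓡 m) M))
      p := by
  have hsingle : ContMDiffAt (𝓡 m) (𝓡 m).tangent ∞
      (fun q : ℝ^m => (Bundle.TotalSpace.mk' (ℝ^m) q (EuclideanSpace.single i (1 : ℝ) : ℝ^m) :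
        TangentBundle (𝓡 m) (ℝ^m))) p :=
    contMDiffAt_vectorSpace_iff_contDiffAt.2 contDiffAt_const
  have hsymm := contMDiffAt_symm_of_mem_maximalAtlas he hp
  exact ContMDiffAt.clm_apply_of_inCoordinates (b₁ := fun q => q)
    (hsymm.mfderiv_const (m := ∞) le_rfl) hsingle hsymm

variable {F : Type*} [NormedAddCommGroup F] [NormedSpace ℝ F]

theorem contDiffAt_comp_chart_symm (he : e ∈ IsManifold.maximalAtlas (𝓡 m) ∞ M)
    (hp : p ∈ e.target) {φ : M → F} (hφ : ContMDiffAt (𝓡 m) 𝓘(ℝ, F) ∞ φ (e.symm p)) :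
    ContDiffAt ℝ ∞ (φ ∘ e.symm) p :=
  (hφ.comp p (contMDiffAt_symm_of_mem_maximalAtlas he hp)).contDiffAt

theorem pd_comp_chart_symm (he : e ∈ IsManifold.maximalAtlas (𝓡 m) ∞ M)
    (hp : p ∈ e.target) {φ : M → F} (hφ : MDifferentiableAt (𝓡 m) 𝓘(ℝ, F) φ (e.symm p))
    (i : Fin m) :
    pd i (φ ∘ e.symm) p = mfderiv (𝓡 m) 𝓘(ℝ, F) φ (e.symm p) (coordVec e i p) := by
  rw [pd, ← mfderiv_eq_fderiv, mfderiv_comp p hφ (mdifferentiableAt_chart_symm he hp)]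
  rfl

theorem exists_chart_symm_eq [IsManifold (𝓡 m) ∞ M] (x : M) :
    ∃ e ∈ IsManifold.maximalAtlas (𝓡 m) ∞ M, ∃ p ∈ e.target, e.symm p = x :=
  ⟨chartAt (ℝ^m) x, IsManifold.chart_mem_maximalAtlas x, chartAt (ℝ^m) x x,
    mem_chart_target _ x, (chartAt (ℝ^m) x).left_inv (mem_chart_source _ x)⟩

variable [IsManifold (𝓡 m) ∞ M]

theorem inner_sum_coordVec (g : Metric m M) (a b : Fin m → ℝ) :
    g.inner (e.symm p) (∑ i, a i • coordVec e i p) (∑ i, b i • coordVec e i p) =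
      a ⬝ᵥ gram g e p *ᵥ b := by
  rw [← sum_mul_mul_eq_dotProduct_mulVec]
  simp only [map_sum, map_smul, sum_apply, smul_apply, smul_eq_mul, gram, Matrix.of_apply,
    Finset.mul_sum]
  rw [Finset.sum_comm]
  exact Finset.sum_congr rfl fun i _ => Finset.sum_congr rfl fun j _ => by ring

theorem gram_posDef (g : Metric m M) (he : e ∈ IsManifold.maximalAtlas (𝓡 m) ∞ M)
    (hp : p ∈ e.target) : (gram g e p).PosDef := by
  refine Matrix.PosDef.of_dotProduct_mulVec_pos (Matrix.ext fun i j => g.symm _ _ _) fun x hx => ?_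
  rw [star_trivial, ← inner_sum_coordVec]
  refine g.pos _ _ fun h => hx ?_
  rw [sum_smul_coordVec] at h
  exact congrArg WithLp.ofLp ((mfderiv_chart_symm_bijective he hp).1 (h.trans (map_zero _).symm))

theorem contDiffAt_gram (g : Metric m M) (he : e ∈ IsManifold.maximalAtlas (𝓡 m) ∞ M)
    (hp : p ∈ e.target) (i j : Fin m) : ContDiffAt ℝ ∞ (fun q => gram g e q i j) p := by
  have hinner : ContMDiffAt (𝓡 m) ((𝓡 m).prod 𝓘(ℝ)) ∞
      (fun q ↦ Bundle.TotalSpace.mk' ℝ (E := Bundle.Trivial M ℝ) (e.symm q)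
        (g.inner (e.symm q) (coordVec e i q) (coordVec e j q))) p :=
    ContMDiffAt.clm_bundle_apply₂ (F₁ := ℝ^m) (F₂ := ℝ^m)
      (g.contMDiff.contMDiffAt.comp p (contMDiffAt_symm_of_mem_maximalAtlas he hp))
      (contMDiffAt_coordVec he hp i) (contMDiffAt_coordVec he hp j)
  rw [Bundle.contMDiffAt_totalSpace] at hinner
  exact contMDiffAt_iff_contDiffAt.1 hinner.2

theorem isEllipticAt_chart (g : Metric m M) (he : e ∈ IsManifold.maximalAtlas (𝓡 m) ∞ M)
    (hp : p ∈ e.target) :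
    IsEllipticAt (fun q => (gram g e q)⁻¹) (fun q => √(gram g e q).det) p where
  posDef := (gram_posDef g he hp).inv
  pos := Real.sqrt_pos.2 (gram_posDef g he hp).det_pos
  contDiffAt_coeff i j := (contDiffAt_matrix_inv (contDiffAt_gram g he hp)
    (gram_posDef g he hp).det_pos.ne' i j).of_le (by simp)
  contDiffAt_density := ((contDiffAt_det (contDiffAt_gram g he hp)).sqrt
    (gram_posDef g he hp).det_pos.ne').of_le (by simp)

theorem coordLaplacian_eq_ellipticOp (g : Metric m M) (e : OpenPartialHomeomorph M (ℝ^m))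
    (φ : M → F) :
    coordLaplacian g e φ = ellipticOp (fun q => (gram g e q)⁻¹) (fun q => √(gram g e q).det)
      (φ ∘ e.symm) :=
  rfl

end Charts

section Manifold

variable {M : Type*} [TopologicalSpace M] [ChartedSpace (ℝ^m) M] [IsManifold (𝓡 m) ∞ M]

theorem eventually_eq_of_isLocalMax_of_coordLaplacian_nonneg (g : Metric m M) {u : M → ℝ}
    (hu : ContMDiff (𝓡 m) 𝓘(ℝ) ∞ u)
    (hL : ∀ e ∈ IsManifold.maximalAtlas (𝓡 m) ∞ M, ∀ p ∈ e.target, 0 ≤ coordLaplacian g e u p)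
    {x : M} (hx : IsLocalMax u x) : ∀ᶠ y in 𝓝 x, u y = u x := by
  obtain ⟨e, he, p, hp, rfl⟩ := exists_chart_symm_eq (m := m) x
  have hmem : ∀ᶠ q in 𝓝 p, q ∈ e.target := e.open_target.mem_nhds hp
  have hconst := eventually_eq_of_isLocalMax (u := u ∘ e.symm)
    (hmem.mono fun q hq => isEllipticAt_chart g he hq)
    (hmem.mono fun q hq => (contDiffAt_comp_chart_symm he hq hu.contMDiffAt).of_le ENat.LEInfty.out)
    (hmem.mono fun q hq => hL e he q hq) ((e.continuousAt_symm hp).eventually hx)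
  rwa [← e.symm.map_nhds_eq hp, eventually_map]

theorem eq_of_coordLaplacian_nonneg [CompactSpace M] [ConnectedSpace M] (g : Metric m M)
    {u : M → ℝ} (hu : ContMDiff (𝓡 m) 𝓘(ℝ) ∞ u)
    (hL : ∀ e ∈ IsManifold.maximalAtlas (𝓡 m) ∞ M, ∀ p ∈ e.target, 0 ≤ coordLaplacian g e u p)
    (x y : M) : u x = u y := by
  obtain ⟨z, -, hz⟩ := isCompact_univ.exists_isMaxOn ⟨x, Set.mem_univ x⟩ hu.continuous.continuousOn
  have hopen : IsOpen {w | u w = u z} := isOpen_iff_mem_nhds.2 fun w hw => by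
    have hmax : IsLocalMax u w := .of_forall fun v => (hz (Set.mem_univ v)).trans_eq hw.symm
    exact (eventually_eq_of_isLocalMax_of_coordLaplacian_nonneg g hu hL hmax).mono
      fun v hv => hv.trans hw
  have hclosed : IsClosed {w | u w = u z} := isClosed_eq hu.continuous continuous_const
  have huniv := IsClopen.eq_univ ⟨hclosed, hopen⟩ ⟨z, rfl⟩
  have h (w : M) : u w = u z := huniv.ge (Set.mem_univ w)
  rw [h x, h y]

theorem IsEigenfunction.norm_eq [CompactSpace M] [ConnectedSpace M] {g : Metric m M} {lam : ℝ}
    {φ : M → ℂ} (hφ : IsEigenfunction g (lam : ℂ) (lam : ℂ) φ) (x y : M) : ‖φ x‖ = ‖φ y‖ := by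
  have h := eq_of_coordLaplacian_nonneg g ((contDiff_norm_sq ℝ).contMDiff.comp hφ.contMDiff)
    (fun e he p hp => ?_) x y
  · exact (sq_eq_sq₀ (norm_nonneg _) (norm_nonneg _)).1 h
  · have hL := hφ.laplacian e he _ (e.map_target hp)
    have hK := hφ.kappa e he _ (e.map_target hp)
    rw [e.right_inv hp] at hL hK
    exact ellipticOp_norm_sq_nonneg (isEllipticAt_chart g he hp)
      ((contDiffAt_comp_chart_symm he hp hφ.contMDiff.contMDiffAt).of_le ENat.LEInfty.out) hL hK

end Manifold

section CircleAngle

open scoped ComplexConjugate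

/-- The `1`-form `dt` on the circle: the angular component of a tangent vector. -/
def circleAngle (z : Circle) : TangentSpace (𝓡 1) z →ₗ[ℝ] ℝ where
  toFun v := (conj (z : ℂ) * circleIncl z v).im
  map_add' v w := by rw [map_add, mul_add, Complex.add_im]
  map_smul' a v := by rw [map_smul, mul_smul_comm, Complex.smul_im, RingHom.id_apply]

theorem inner_circleIncl (z : Circle) (v : TangentSpace (𝓡 1) z) :
    inner ℝ (z : ℂ) (circleIncl z v) = 0 := by
  have : Fact (Module.finrank ℝ ℂ = 1 + 1) := finrank_real_complex_fact'
  have hrange := range_mvfderiv_subtypeVal (E := ℂ) (n := 1) z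
  exact Submodule.mem_orthogonal_singleton_iff_inner_right.1 (hrange.le ⟨v, rfl⟩)

theorem circleIncl_eq (z : Circle) (v : TangentSpace (𝓡 1) z) :
    circleIncl z v = circleAngle z v • (Complex.I * z) := by
  have hre : (conj (z : ℂ) * circleIncl z v).re = 0 := by
    rw [mul_comm]
    exact inner_circleIncl z v
  have himag : conj (z : ℂ) * circleIncl z v = circleAngle z v * Complex.I :=
    Complex.ext (by simpa using hre) (by simp [circleAngle])
  calc circleIncl z v = z * (conj (z : ℂ) * circleIncl z v) := by
        rw [← mul_assoc, Complex.mul_conj', Circle.norm_coe, Complex.ofReal_one, one_pow, one_mul]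
    _ = circleAngle z v • (Complex.I * z) := by
        rw [himag, Complex.real_smul]
        ring

theorem circleAngle_injective (z : Circle) : Function.Injective (circleAngle z) := fun v w h =>
  circleIncl_injective z (by rw [circleIncl_eq, circleIncl_eq, h])

theorem circleForm_eq (c : ℝ) (z : Circle) (v w : TangentSpace (𝓡 1) z) :
    circleForm c z v w = c * (circleAngle z v * circleAngle z w) := by
  rw [circleForm_apply, circleIncl_eq, circleIncl_eq, real_inner_smul_left, real_inner_smul_right,
    real_inner_self_eq_norm_sq, norm_mul, Complex.norm_I, Circle.norm_coe]
  ring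

variable {M : Type*} [TopologicalSpace M] [ChartedSpace (ℝ^m) M] {π : M → Circle}

/-- The pullback `π^*dt` of the angular form to the domain of a circle-valued map. -/
def angleForm (π : M → Circle) (x : M) : TangentSpace (𝓡 m) x →ₗ[ℝ] ℝ :=
  circleAngle (π x) ∘ₗ (mfderiv (𝓡 m) (𝓡 1) π x).toLinearMap

/-- The components of `π^*dt` in the chart `e`, as functions of the coordinates. -/
def angleCoord (π : M → Circle) (e : OpenPartialHomeomorph M (ℝ^m)) (i : Fin m) (p : ℝ^m) : ℝ :=
  angleForm π (e.symm p) (coordVec e i p)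

theorem angleForm_eq_zero_iff {x : M} {v : TangentSpace (𝓡 m) x} :
    angleForm π x v = 0 ↔ mfderiv (𝓡 m) (𝓡 1) π x v = 0 :=
  map_eq_zero_iff (circleAngle (π x)) (circleAngle_injective _)

theorem surjective_mfderiv_iff_angleForm_ne_zero {x : M} :
    Function.Surjective (mfderiv (𝓡 m) (𝓡 1) π x) ↔ angleForm (m := m) π x ≠ 0 := by
  constructor
  · intro hsurj hzero
    obtain ⟨v, hv⟩ := hsurj (EuclideanSpace.single 0 1 : ℝ^1)
    have hv₀ : mfderiv (𝓡 m) (𝓡 1) π x v = 0 :=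
      angleForm_eq_zero_iff.1 (LinearMap.congr_fun hzero v)
    have hsingle : (EuclideanSpace.single 0 1 : ℝ^1) = 0 := hv.symm.trans hv₀
    simp at hsingle
  · intro hne w
    obtain ⟨v, hv⟩ := DFunLike.ne_iff.1 hne
    refine ⟨(circleAngle (π x) w / angleForm π x v) • v, circleAngle_injective _ ?_⟩
    exact (map_smul (angleForm π x) _ v).trans (div_mul_cancel₀ _ hv)

variable {e : OpenPartialHomeomorph M (ℝ^m)} {p : ℝ^m}

theorem pd_circle_comp_chart_symm (he : e ∈ IsManifold.maximalAtlas (𝓡 m) ∞ M) (hp : p ∈ e.target)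
    (hπ : MDifferentiableAt (𝓡 m) (𝓡 1) π (e.symm p)) (i : Fin m) :
    pd i ((fun x => (π x : ℂ)) ∘ e.symm) p =
      angleCoord π e i p • (Complex.I * (π (e.symm p) : ℂ)) := by
  have hcoe : MDifferentiableAt (𝓡 1) 𝓘(ℝ, ℂ) (fun w : Circle => (w : ℂ)) (π (e.symm p)) :=
    contMDiff_circle_coe.mdifferentiableAt (by simp)
  have hchain : mfderiv (𝓡 m) 𝓘(ℝ, ℂ) (fun x => (π x : ℂ)) (e.symm p) (coordVec e i p) =
      circleIncl (π (e.symm p)) (mfderiv (𝓡 m) (𝓡 1) π (e.symm p) (coordVec e i p)) :=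
    DFunLike.congr_fun (mfderiv_comp (e.symm p) hcoe hπ) (coordVec e i p)
  exact (pd_comp_chart_symm he hp (hcoe.comp (e.symm p) hπ) i).trans
    (hchain.trans (circleIncl_eq _ _))

theorem contDiffAt_angleCoord (he : e ∈ IsManifold.maximalAtlas (𝓡 m) ∞ M) (hp : p ∈ e.target)
    (hπ : ContMDiff (𝓡 m) (𝓡 1) ∞ π) (i : Fin m) : ContDiffAt ℝ ∞ (angleCoord π e i) p := by
  have hP : ContDiffAt ℝ ∞ ((fun x => (π x : ℂ)) ∘ e.symm) p :=
    contDiffAt_comp_chart_symm he hp (contMDiff_circle_coe.comp hπ).contMDiffAt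
  have hconj : ContDiffAt ℝ ∞ (fun q => conj (π (e.symm q) : ℂ)) p :=
    Complex.conjCLE.contDiff.contDiffAt.comp p hP
  refine (Complex.imCLM.contDiff.contDiffAt.comp p
    (hconj.mul (contDiffAt_pd (k := ∞) hP le_rfl i))).congr_of_eventuallyEq ?_
  filter_upwards [e.open_target.mem_nhds hp] with q hq
  have hunit : conj (π (e.symm q) : ℂ) * π (e.symm q) = 1 := by
    rw [Complex.conj_mul', Circle.norm_coe, Complex.ofReal_one, one_pow]
  rw [Function.comp_apply,
    pd_circle_comp_chart_symm he hq (hπ.mdifferentiableAt (by simp)), mul_smul_comm,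
    mul_left_comm, hunit]
  simp

end CircleAngle

section CircleChart

variable {f : OpenPartialHomeomorph Circle (ℝ^1)} {q : ℝ^1}

theorem pd_circle_chart_symm (hf : f ∈ IsManifold.maximalAtlas (𝓡 1) ∞ Circle) (hq : q ∈ f.target) :
    pd 0 (fun r => (f.symm r : ℂ)) q = angleCoord id f 0 q • (Complex.I * (f.symm q : ℂ)) :=
  pd_circle_comp_chart_symm (π := id) hf hq mdifferentiableAt_id 0

theorem angleCoord_id_apply (f : OpenPartialHomeomorph Circle (ℝ^1)) (q : ℝ^1) :
    angleCoord id f 0 q = circleAngle (f.symm q) (coordVec f 0 q) := by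
  rw [angleCoord, angleForm, mfderiv_id]
  rfl

theorem angleCoord_id_ne_zero (hf : f ∈ IsManifold.maximalAtlas (𝓡 1) ∞ Circle)
    (hq : q ∈ f.target) : angleCoord id f 0 q ≠ 0 := by
  rw [angleCoord_id_apply]
  intro h
  have hvec : coordVec f 0 q = 0 := (map_eq_zero_iff _ (circleAngle_injective _)).1 h
  have hsingle : (EuclideanSpace.single 0 1 : ℝ^1) = 0 :=
    (map_eq_zero_iff _ (mfderiv_chart_symm_bijective hf hq).1).1 hvec
  simp at hsingle

theorem gram_circleMetric {c : ℝ} (hc : 0 < c) (f : OpenPartialHomeomorph Circle (ℝ^1)) (q : ℝ^1) :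
    gram (circleMetric c hc) f q 0 0 = c * angleCoord id f 0 q ^ 2 := by
  rw [angleCoord_id_apply, sq]
  exact circleForm_eq c _ _ _

-- The coordinate `s` of `f` and the angle `t` are related by `dt = a ds`, whence `Γ = a' / a`.
theorem christoffel_circleMetric_mul_angleCoord {c : ℝ} (hc : 0 < c)
    (hf : f ∈ IsManifold.maximalAtlas (𝓡 1) ∞ Circle) (hq : q ∈ f.target) :
    christoffel (circleMetric c hc) f 0 0 0 q * angleCoord id f 0 q =
      pd 0 (angleCoord id f 0) q := by
  have ha : DifferentiableAt ℝ (angleCoord id f 0) q :=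
    (contDiffAt_angleCoord hf hq contMDiff_id 0).differentiableAt (by simp)
  have hsq : pd 0 (fun r => gram (circleMetric c hc) f r 0 0) q =
      2 * c * angleCoord id f 0 q * pd 0 (angleCoord id f 0) q := by
    simp only [gram_circleMetric, pd]
    rw [((ha.hasFDerivAt.pow 2).const_mul c).fderiv]
    simp
    ring
  have hinv : (gram (circleMetric c hc) f q)⁻¹ 0 0 = (c * angleCoord id f 0 q ^ 2)⁻¹ := by
    rw [← gram_circleMetric hc]
    simp
  have ha₀ := angleCoord_id_ne_zero hf hq
  simp only [christoffel, Finset.univ_unique, Fin.default_eq_zero, Finset.sum_singleton, hsq, hinv]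
  field_simp
  ring

end CircleChart

section CircleValued

theorem pd_comp_euclidean {F : Type*} [NormedAddCommGroup F] [NormedSpace ℝ F] {n : ℕ}
    {Y : ℝ^m → ℝ^n} {h : ℝ^n → F} {p : ℝ^m} (hY : DifferentiableAt ℝ Y p)
    (hh : DifferentiableAt ℝ h (Y p)) (i : Fin m) :
    pd i (fun q => h (Y q)) p = ∑ α, pd i (fun q => Y q α) p • pd α h (Y p) := by
  have hcoord (α : Fin n) : pd i (fun q => Y q α) p = pd i Y p α :=
    pd_clm_comp (EuclideanSpace.proj (𝕜 := ℝ) α) hY i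
  simp only [hcoord, sum_smul_pd]
  exact DFunLike.congr_fun (fderiv_comp p hh hY) _

variable {M : Type*} [TopologicalSpace M] [ChartedSpace (ℝ^m) M]
  {e : OpenPartialHomeomorph M (ℝ^m)} {p : ℝ^m}

theorem contDiffAt_chart_comp_chart_symm {n : ℕ} {N : Type*} [TopologicalSpace N]
    [ChartedSpace (ℝ^n) N] {f : OpenPartialHomeomorph N (ℝ^n)} {π : M → N}
    (he : e ∈ IsManifold.maximalAtlas (𝓡 m) ∞ M) (hp : p ∈ e.target)
    (hf : f ∈ IsManifold.maximalAtlas (𝓡 n) ∞ N) (hpf : π (e.symm p) ∈ f.source)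
    (hπ : ContMDiffAt (𝓡 m) (𝓡 n) ∞ π (e.symm p)) :
    ContDiffAt ℝ ∞ (fun q => f (π (e.symm q))) p :=
  ((contMDiffAt_of_mem_maximalAtlas hf hpf).comp p
    (hπ.comp p (contMDiffAt_symm_of_mem_maximalAtlas he hp))).contDiffAt

variable {π : M → Circle} {f : OpenPartialHomeomorph Circle (ℝ^1)}

theorem angleCoord_eq_mul_pd (he : e ∈ IsManifold.maximalAtlas (𝓡 m) ∞ M) (hp : p ∈ e.target)
    (hf : f ∈ IsManifold.maximalAtlas (𝓡 1) ∞ Circle) (hpf : π (e.symm p) ∈ f.source)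
    (hπ : ContMDiff (𝓡 m) (𝓡 1) ∞ π) (i : Fin m) :
    angleCoord π e i p =
      pd i (fun q => f (π (e.symm q)) 0) p * angleCoord id f 0 (f (π (e.symm p))) := by
  have hY : DifferentiableAt ℝ (fun q => f (π (e.symm q))) p :=
    (contDiffAt_chart_comp_chart_symm he hp hf hpf hπ.contMDiffAt).differentiableAt (by simp)
  have hQ : f (π (e.symm p)) ∈ f.target := f.map_source hpf
  have hcoe : DifferentiableAt ℝ (fun r => (f.symm r : ℂ)) (f (π (e.symm p))) :=
    (contDiffAt_comp_chart_symm hf hQ contMDiff_circle_coe.contMDiffAt).differentiableAt (by simp)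
  have hlocal : (fun x => (π x : ℂ)) ∘ e.symm =ᶠ[𝓝 p] fun q => (f.symm (f (π (e.symm q))) : ℂ) := by
    filter_upwards [(hπ.continuous.continuousAt.comp (e.continuousAt_symm hp)).eventually
        (f.open_source.mem_nhds hpf)] with q hq
    exact congrArg _ (f.left_inv hq).symm
  have h := (pd_eventuallyEq hlocal i).eq_of_nhds
  rw [pd_circle_comp_chart_symm he hp (hπ.mdifferentiableAt (by simp)),
    pd_comp_euclidean hY hcoe, Fin.sum_univ_one, pd_circle_chart_symm hf hQ, f.left_inv hpf,
    smul_smul] at h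
  exact smul_left_injective ℝ (mul_ne_zero Complex.I_ne_zero (Circle.coe_ne_zero _)) h

variable [IsManifold (𝓡 m) ∞ M]

/-- The squared length `|π^*dt|²` of the form `π^*dt` with respect to `g`, in the chart `e`. -/
def angleNormSq (g : Metric m M) (π : M → Circle) (e : OpenPartialHomeomorph M (ℝ^m)) (p : ℝ^m) :
    ℝ :=
  (angleCoord π e · p) ⬝ᵥ (gram g e p)⁻¹ *ᵥ (angleCoord π e · p)

/-- The divergence of the form `π^*dt` with respect to `g`, in the chart `e`. -/
def angleDiv (g : Metric m M) (π : M → Circle) (e : OpenPartialHomeomorph M (ℝ^m)) (p : ℝ^m) : ℝ :=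
  weightedDiv (fun q => (gram g e q)⁻¹) (fun q => √(gram g e q).det) (angleCoord π e) p

theorem coordKappa_circle (g : Metric m M) (he : e ∈ IsManifold.maximalAtlas (𝓡 m) ∞ M)
    (hp : p ∈ e.target) (hπ : ContMDiff (𝓡 m) (𝓡 1) ∞ π) :
    coordKappa g e (fun x => (π x : ℂ)) (fun x => (π x : ℂ)) p =
      (-angleNormSq g π e p : ℝ) * (π (e.symm p) : ℂ) ^ 2 := by
  simp only [coordKappa, pd_circle_comp_chart_symm he hp (hπ.mdifferentiableAt (by simp)),
    angleNormSq, ← sum_mul_mul_eq_dotProduct_mulVec, Complex.real_smul]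
  push_cast
  simp only [Finset.sum_mul, ← Finset.sum_neg_distrib]
  refine Finset.sum_congr rfl fun i _ => Finset.sum_congr rfl fun j _ => ?_
  linear_combination (gram g e p)⁻¹ i j * angleCoord π e i p * angleCoord π e j p *
    (π (e.symm p) : ℂ) ^ 2 * Complex.I_sq

theorem coordLaplacian_circle (g : Metric m M) (he : e ∈ IsManifold.maximalAtlas (𝓡 m) ∞ M)
    (hp : p ∈ e.target) (hπ : ContMDiff (𝓡 m) (𝓡 1) ∞ π) :
    coordLaplacian g e (fun x => (π x : ℂ)) p =
      (-angleNormSq g π e p + angleDiv g π e p * Complex.I) * π (e.symm p) := by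
  have hθ (i : Fin m) : DifferentiableAt ℝ (angleCoord π e i) p :=
    (contDiffAt_angleCoord he hp hπ i).differentiableAt (by simp)
  have hP : DifferentiableAt ℝ ((fun x => (π x : ℂ)) ∘ e.symm) p :=
    (contDiffAt_comp_chart_symm he hp
      (contMDiff_circle_coe.comp hπ).contMDiffAt).differentiableAt (by simp)
  have hpd {q : ℝ^m} (hq : q ∈ e.target) (i : Fin m) :=
    pd_circle_comp_chart_symm he hq (hπ.mdifferentiableAt (by simp)) i
  have hrot (j : Fin m) : pd j (fun q => Complex.I * (π (e.symm q) : ℂ)) p =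
      -(angleCoord π e j p • (π (e.symm p) : ℂ)) := by
    refine (pd_clm_comp (ContinuousLinearMap.mul ℝ ℂ Complex.I) hP j).trans ?_
    rw [hpd hp, map_smul, ← smul_neg, ContinuousLinearMap.mul_apply', ← mul_assoc,
      Complex.I_mul_I, neg_one_mul]
  have hdiv := weightedDiv_smul (isEllipticAt_chart g he hp) hθ (hP.const_mul Complex.I)
  rw [coordLaplacian_eq_ellipticOp]
  refine (weightedDiv_congr fun i => ?_).trans (hdiv.trans ?_)
  · filter_upwards [e.open_target.mem_nhds hp] with q hq using hpd hq i
  · simp only [Function.comp_apply, hrot, smul_neg, smul_smul, Finset.sum_neg_distrib,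
      ← Finset.sum_smul, sum_mul_mul_eq_dotProduct_mulVec]
    rw [angleDiv, angleNormSq, Complex.real_smul, Complex.real_smul]
    ring

theorem angleCoord_mul_coordTension (g : Metric m M) {c : ℝ} (hc : 0 < c)
    (he : e ∈ IsManifold.maximalAtlas (𝓡 m) ∞ M) (hp : p ∈ e.target)
    (hf : f ∈ IsManifold.maximalAtlas (𝓡 1) ∞ Circle) (hpf : π (e.symm p) ∈ f.source)
    (hπ : ContMDiff (𝓡 m) (𝓡 1) ∞ π) :
    angleCoord id f 0 (f (π (e.symm p))) * coordTension g (circleMetric c hc) e f π 0 p =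
      angleDiv g π e p := by
  let Y : ℝ^m → ℝ^1 := fun q => f (π (e.symm q))
  have hY : ContDiffAt ℝ ∞ Y p := contDiffAt_chart_comp_chart_symm he hp hf hpf hπ.contMDiffAt
  have hy : ContDiffAt ℝ 2 (fun q => Y q 0) p :=
    ((EuclideanSpace.proj (𝕜 := ℝ) (0 : Fin 1)).contDiff.contDiffAt.comp p hY).of_le
      ENat.LEInfty.out
  have hY₁ : DifferentiableAt ℝ Y p := hY.differentiableAt (by simp)
  have hQ : Y p ∈ f.target := f.map_source hpf
  have ha : DifferentiableAt ℝ (angleCoord id f 0) (Y p) :=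
    (contDiffAt_angleCoord hf hQ contMDiff_id 0).differentiableAt (by simp)
  have hdiv : angleDiv g π e p = weightedDiv (fun q => (gram g e q)⁻¹) (fun q => √(gram g e q).det)
      (fun i q => pd i (fun q => Y q 0) q • angleCoord id f 0 (Y q)) p := by
    refine weightedDiv_congr fun i => ?_
    filter_upwards [e.open_target.mem_nhds hp,
      (hπ.continuous.continuousAt.comp (e.continuousAt_symm hp)).eventually
        (f.open_source.mem_nhds hpf)] with q hq hqf
    exact angleCoord_eq_mul_pd he hq hf hqf hπ i
  rw [hdiv, weightedDiv_smul (isEllipticAt_chart g he hp) (differentiableAt_pd hy)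
    (ha.fun_comp' p hY₁)]
  simp only [pd_comp_euclidean hY₁ ha, Fin.sum_univ_one,
    ← christoffel_circleMetric_mul_angleCoord hc hf hQ, coordTension]
  have hlap : coordLaplacian g e (fun x => f (π x) 0) p =
      ellipticOp (fun q => (gram g e q)⁻¹) (fun q => √(gram g e q).det) (fun q => Y q 0) p := rfl
  rw [hlap, ellipticOp, mul_add, mul_comm, smul_eq_mul]
  simp only [Finset.mul_sum, smul_eq_mul]
  refine congrArg₂ (· + ·) rfl (Finset.sum_congr rfl fun i _ => Finset.sum_congr rfl fun j _ => ?_)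
  simp only [Y]
  ring

end CircleValued

section Submersion

variable {n : ℕ} {M N : Type*} [TopologicalSpace M] [ChartedSpace (ℝ^m) M] [IsManifold (𝓡 m) ∞ M]
  [TopologicalSpace N] [ChartedSpace (ℝ^n) N] [IsManifold (𝓡 n) ∞ N] {π : M → N}

theorem map_nhds_eq_of_surjective_mfderiv {x : M} (hπ : ContMDiffAt (𝓡 m) (𝓡 n) ∞ π x)
    (hsurj : Function.Surjective (mfderiv (𝓡 m) (𝓡 n) π x)) : map π (𝓝 x) = 𝓝 (π x) := by
  obtain ⟨e, he, p, hp, rfl⟩ := exists_chart_symm_eq (m := m) x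
  obtain ⟨f, hf, q, hq, hqx⟩ := exists_chart_symm_eq (m := n) (π (e.symm p))
  have hpf : π (e.symm p) ∈ f.source := hqx ▸ f.map_target hq
  have hY : ContDiffAt ℝ ∞ (f ∘ π ∘ e.symm) p := contDiffAt_chart_comp_chart_symm he hp hf hpf hπ
  have hY' : Function.Surjective (fderiv ℝ (f ∘ π ∘ e.symm) p) := by
    have hf' := (mdifferentiable_chart hf).mdifferentiableAt hpf
    have he' := mdifferentiableAt_chart_symm he hp
    have hπ' := hπ.mdifferentiableAt (by simp)
    rw [← mfderiv_eq_fderiv, mfderiv_comp p hf' (hπ'.comp p he'), mfderiv_comp p hπ' he']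
    exact ((mdifferentiable_chart hf).mfderiv_surjective hpf).comp
      (hsurj.comp (mfderiv_chart_symm_bijective he hp).2)
  have hmap : map f (map π (𝓝 (e.symm p))) = map f (𝓝 (π (e.symm p))) := by
    rw [f.map_nhds_eq hpf, ← e.symm.map_nhds_eq hp, map_map, map_map]
    exact (hY.hasStrictFDerivAt (by simp)).map_nhds_eq_of_surj (LinearMap.range_eq_top.2 hY')
  exact (map_eq_map_iff_of_injOn (hπ.continuousAt (f.open_source.mem_nhds hpf))
    (f.open_source.mem_nhds hpf) f.injOn).1 hmap

theorem surjective_of_surjective_mfderiv [CompactSpace M] [Nonempty M] [T2Space N]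
    [PreconnectedSpace N] (hπ : ContMDiff (𝓡 m) (𝓡 n) ∞ π)
    (hsurj : ∀ x, Function.Surjective (mfderiv (𝓡 m) (𝓡 n) π x)) : Function.Surjective π := by
  have hopen : IsOpenMap π := isOpenMap_iff_nhds_le.2 fun x =>
    (map_nhds_eq_of_surjective_mfderiv hπ.contMDiffAt (hsurj x)).ge
  exact Set.range_eq_univ.1 <| IsClopen.eq_univ
    ⟨(isCompact_range hπ.continuous).isClosed, hopen.isOpen_range⟩ (Set.range_nonempty π)

end Submersion

section KernelComplement

variable {V : Type*} [AddCommGroup V] [Module ℝ V] {B : V →ₗ[ℝ] V →ₗ[ℝ] ℝ} {η : V →ₗ[ℝ] ℝ} {n : V}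

theorem eq_smul_of_orthogonal_ker (hB : ∀ v, v ≠ 0 → 0 < B v v) (hn : ∀ v, B n v = η v)
    (hηn : η n ≠ 0) {v : V} (hv : ∀ u, η u = 0 → B v u = 0) : v = (η v / η n) • n := by
  by_contra hne
  have hker : η (v - (η v / η n) • n) = 0 := by
    rw [map_sub, map_smul, smul_eq_mul, div_mul_cancel₀ _ hηn, sub_self]
  have hpos := hB _ (sub_ne_zero.2 hne)
  rw [LinearMap.map_sub₂, hv _ hker, LinearMap.map_smul₂, hn, hker, smul_zero, sub_zero] at hpos
  exact hpos.false

theorem ne_zero_and_isometric_orthogonal_ker_iff (hB : ∀ v, v ≠ 0 → 0 < B v v)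
    (hn : ∀ v, B n v = η v) (c : ℝ) :
    (η ≠ 0 ∧ ∀ v w, (∀ u, η u = 0 → B v u = 0) → (∀ u, η u = 0 → B w u = 0) →
      c * (η v * η w) = B v w) ↔ c * η n = 1 := by
  constructor
  · rintro ⟨hη, hiso⟩
    have hn₀ : n ≠ 0 := by
      rintro rfl
      exact hη (LinearMap.ext fun v => by simp [← hn v])
    have hηn : η n ≠ 0 := hn n ▸ (hB n hn₀).ne'
    have hort (u : V) (hu : η u = 0) : B n u = 0 := (hn u).trans hu
    exact mul_right_cancel₀ hηn (by linarith [hiso n n hort hort, hn n])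
  · intro h
    have hηn : η n ≠ 0 := right_ne_zero_of_mul_eq_one h
    refine ⟨fun hη => hηn (LinearMap.congr_fun hη n), fun v w hv _ => ?_⟩
    nth_rewrite 2 [eq_smul_of_orthogonal_ker hB hn hηn hv]
    rw [LinearMap.map_smul₂, hn, smul_eq_mul]
    field_simp
    linear_combination η v * η w * h

end KernelComplement

section CircleSubmersion

variable {M : Type*} [TopologicalSpace M] [ChartedSpace (ℝ^m) M] [IsManifold (𝓡 m) ∞ M]
  {e : OpenPartialHomeomorph M (ℝ^m)} {p : ℝ^m} {π : M → Circle} {c : ℝ}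

theorem exists_gradient (g : Metric m M) (he : e ∈ IsManifold.maximalAtlas (𝓡 m) ∞ M)
    (hp : p ∈ e.target) (η : TangentSpace (𝓡 m) (e.symm p) →ₗ[ℝ] ℝ) :
    ∃ n, (∀ v, g.inner (e.symm p) n v = η v) ∧
      η n = (fun i => η (coordVec e i p)) ⬝ᵥ (gram g e p)⁻¹ *ᵥ fun i => η (coordVec e i p) := by
  let θ : Fin m → ℝ := fun i => η (coordVec e i p)
  have hη (a : Fin m → ℝ) : η (∑ i, a i • coordVec e i p) = a ⬝ᵥ θ := by
    simp only [map_sum, map_smul, smul_eq_mul, dotProduct, θ]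
  have hdet : IsUnit (gram g e p).det := (gram_posDef g he hp).det_pos.ne'.isUnit
  refine ⟨∑ i, ((gram g e p)⁻¹ *ᵥ θ) i • coordVec e i p, fun v => ?_, ?_⟩
  · obtain ⟨b, rfl⟩ := exists_eq_sum_coordVec he hp v
    rw [g.symm, inner_sum_coordVec, Matrix.mulVec_mulVec, Matrix.mul_nonsing_inv _ hdet,
      Matrix.one_mulVec, hη]
  · rw [hη, dotProduct_comm]

/-- The differential of `π : (M, g) → (N, h)` at `x` is onto and is isometric on the orthogonal
complement of its kernel: the pointwise part of `IsRiemannianSubmersion`. -/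
def IsRiemannianSubmersionAt {n : ℕ} {N : Type*} [TopologicalSpace N] [ChartedSpace (ℝ^n) N]
    [IsManifold (𝓡 n) ∞ N] (g : Metric m M) (h : Metric n N) (π : M → N) (x : M) : Prop :=
  Function.Surjective (mfderiv (𝓡 m) (𝓡 n) π x) ∧
    ∀ v w : TangentSpace (𝓡 m) x,
      (∀ u, mfderiv (𝓡 m) (𝓡 n) π x u = 0 → g.inner x v u = 0) →
      (∀ u, mfderiv (𝓡 m) (𝓡 n) π x u = 0 → g.inner x w u = 0) →
      h.inner (π x) (mfderiv (𝓡 m) (𝓡 n) π x v) (mfderiv (𝓡 m) (𝓡 n) π x w) = g.inner x v w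

theorem isRiemannianSubmersionAt_circle_iff (g : Metric m M) (hc : 0 < c)
    (he : e ∈ IsManifold.maximalAtlas (𝓡 m) ∞ M) (hp : p ∈ e.target) :
    IsRiemannianSubmersionAt g (circleMetric c hc) π (e.symm p) ↔ c * angleNormSq g π e p = 1 := by
  have hinner (v w : TangentSpace (𝓡 m) (e.symm p)) : (circleMetric c hc).inner (π (e.symm p))
      (mfderiv (𝓡 m) (𝓡 1) π (e.symm p) v) (mfderiv (𝓡 m) (𝓡 1) π (e.symm p) w) =
      c * (angleForm π (e.symm p) v * angleForm π (e.symm p) w) := circleForm_eq c _ _ _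
  obtain ⟨n, hn, hηn⟩ := exists_gradient g he hp (angleForm π (e.symm p))
  simp only [IsRiemannianSubmersionAt, surjective_mfderiv_iff_angleForm_ne_zero,
    ← angleForm_eq_zero_iff, hinner]
  refine (ne_zero_and_isometric_orthogonal_ker_iff (V := TangentSpace (𝓡 m) (e.symm p))
    (B := (ContinuousLinearMap.coeLM ℝ).comp (g.inner (e.symm p)).toLinearMap)
    (g.pos (e.symm p)) hn c).trans ?_
  rw [hηn]
  rfl

theorem isRiemannianSubmersion_circle_iff [CompactSpace M] [Nonempty M] (g : Metric m M)
    (hc : 0 < c) (hπ : ContMDiff (𝓡 m) (𝓡 1) ∞ π) :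
    IsRiemannianSubmersion g (circleMetric c hc) π ↔
      ∀ e ∈ IsManifold.maximalAtlas (𝓡 m) ∞ M, ∀ p ∈ e.target, c * angleNormSq g π e p = 1 := by
  constructor
  · intro h e he p hp
    exact (isRiemannianSubmersionAt_circle_iff g hc he hp).1
      ⟨h.surjective_mfderiv _, h.isometric _⟩
  · intro h
    have hpoint (x : M) : IsRiemannianSubmersionAt g (circleMetric c hc) π x := by
      obtain ⟨e, he, p, hp, rfl⟩ := exists_chart_symm_eq (m := m) x
      exact (isRiemannianSubmersionAt_circle_iff g hc he hp).2 (h e he p hp)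
    exact ⟨hπ, surjective_of_surjective_mfderiv hπ fun x => (hpoint x).1, fun x => (hpoint x).1,
      fun x => (hpoint x).2⟩

theorem isHarmonicMap_circle_iff (g : Metric m M) (hc : 0 < c) (hπ : ContMDiff (𝓡 m) (𝓡 1) ∞ π) :
    IsHarmonicMap g (circleMetric c hc) π ↔
      ∀ e ∈ IsManifold.maximalAtlas (𝓡 m) ∞ M, ∀ p ∈ e.target, angleDiv g π e p = 0 := by
  constructor
  · intro h e he p hp
    obtain ⟨f, hf, q, hq, hqx⟩ := exists_chart_symm_eq (m := 1) (π (e.symm p))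
    have hpf : π (e.symm p) ∈ f.source := hqx ▸ f.map_target hq
    have htension := h.tension_eq_zero e he f hf _ (e.map_target hp) hpf 0
    rw [e.right_inv hp] at htension
    rw [← angleCoord_mul_coordTension g hc he hp hf hpf hπ, htension, mul_zero]
  · refine fun h => ⟨hπ, fun e he f hf x hx hxf γ => ?_⟩
    have hpf : π (e.symm (e x)) ∈ f.source := by rwa [e.left_inv hx]
    have hmul := angleCoord_mul_coordTension g hc he (e.map_source hx) hf hpf hπ
    rw [h e he _ (e.map_source hx)] at hmul
    rw [Subsingleton.elim γ 0]
    exact (mul_eq_zero.1 hmul).resolve_left (angleCoord_id_ne_zero hf (f.map_source hpf))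

theorem isEigenfunction_circle_iff (g : Metric m M) (lam : ℝ) (hπ : ContMDiff (𝓡 m) (𝓡 1) ∞ π) :
    IsEigenfunction g (lam : ℂ) (lam : ℂ) (fun x => (π x : ℂ)) ↔
      ∀ e ∈ IsManifold.maximalAtlas (𝓡 m) ∞ M, ∀ p ∈ e.target,
        angleDiv g π e p = 0 ∧ -angleNormSq g π e p = lam := by
  constructor
  · intro h e he p hp
    have hlap := h.laplacian e he _ (e.map_target hp)
    rw [e.right_inv hp, coordLaplacian_circle g he hp hπ,
      mul_left_inj' (Circle.coe_ne_zero _)] at hlap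
    exact ⟨by simpa using congrArg Complex.im hlap, by simpa using congrArg Complex.re hlap⟩
  · intro h
    refine ⟨contMDiff_circle_coe.comp hπ, fun e he x hx => ?_, fun e he x hx => ?_⟩
    · obtain ⟨hdiv, hnorm⟩ := h e he _ (e.map_source hx)
      rw [coordLaplacian_circle g he (e.map_source hx) hπ, hdiv, ← Complex.ofReal_neg, hnorm,
        e.left_inv hx, Complex.ofReal_zero, zero_mul, add_zero]
    · rw [coordKappa_circle g he (e.map_source hx) hπ, (h e he _ (e.map_source hx)).2,
        e.left_inv hx]

theorem contMDiff_circle_of_coe {π : M → Circle}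
    (hπ : ContMDiff (𝓡 m) 𝓘(ℝ, ℂ) ∞ (fun x => (π x : ℂ))) : ContMDiff (𝓡 m) (𝓡 1) ∞ π :=
  have : Fact (Module.finrank ℝ ℂ = 1 + 1) := finrank_real_complex_fact'
  ContMDiff.codRestrict_sphere (n := 1) hπ fun x => (π x).2

theorem isEigenfunction_circle_iff_isHarmonicMap_and_isRiemannianSubmersion [CompactSpace M]
    [Nonempty M] (g : Metric m M) {lam : ℝ} (hc : 0 < c) (hlam : c * lam = -1) :
    IsEigenfunction g (lam : ℂ) (lam : ℂ) (fun x => (π x : ℂ)) ↔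
      IsHarmonicMap g (circleMetric c hc) π ∧ IsRiemannianSubmersion g (circleMetric c hc) π := by
  suffices hsmooth : ContMDiff (𝓡 m) (𝓡 1) ∞ π →
      (IsEigenfunction g (lam : ℂ) (lam : ℂ) (fun x => (π x : ℂ)) ↔
        IsHarmonicMap g (circleMetric c hc) π ∧ IsRiemannianSubmersion g (circleMetric c hc) π) from
    ⟨fun h => (hsmooth (contMDiff_circle_of_coe h.contMDiff)).1 h,
      fun h => (hsmooth h.1.contMDiff).2 h⟩
  intro hπ
  rw [isEigenfunction_circle_iff g lam hπ, isHarmonicMap_circle_iff g hc hπ,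
    isRiemannianSubmersion_circle_iff g hc hπ]
  have hnorm (a : ℝ) : -a = lam ↔ c * a = 1 := by
    rw [← mul_right_inj' hc.ne', hlam, mul_neg, neg_inj]
  simp only [hnorm, ← forall_and]

end CircleSubmersion

section Normalization

variable {M : Type*} [TopologicalSpace M] [ChartedSpace (ℝ^m) M] [IsManifold (𝓡 m) ∞ M]
  {g : Metric m M} {lam mu : ℂ} {φ : M → ℂ}

theorem coordLaplacian_const_mul {e : OpenPartialHomeomorph M (ℝ^m)} {p : ℝ^m}
    (he : e ∈ IsManifold.maximalAtlas (𝓡 m) ∞ M) (hp : p ∈ e.target)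
    (hφ : ContMDiff (𝓡 m) 𝓘(ℝ, ℂ) ∞ φ) (a : ℂ) :
    coordLaplacian g e (fun x => a * φ x) p = a * coordLaplacian g e φ p :=
  ellipticOp_clm_comp (ContinuousLinearMap.mul ℝ ℂ a) (isEllipticAt_chart g he hp)
    ((contDiffAt_comp_chart_symm he hp hφ.contMDiffAt).of_le ENat.LEInfty.out)

theorem coordKappa_const_mul {e : OpenPartialHomeomorph M (ℝ^m)} {p : ℝ^m}
    (he : e ∈ IsManifold.maximalAtlas (𝓡 m) ∞ M) (hp : p ∈ e.target)
    (hφ : ContMDiff (𝓡 m) 𝓘(ℝ, ℂ) ∞ φ) (a : ℂ) :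
    coordKappa g e (fun x => a * φ x) (fun x => a * φ x) p = a ^ 2 * coordKappa g e φ φ p := by
  have hpd (i : Fin m) : pd i ((fun x => a * φ x) ∘ e.symm) p = a * pd i (φ ∘ e.symm) p :=
    pd_clm_comp (ContinuousLinearMap.mul ℝ ℂ a)
      ((contDiffAt_comp_chart_symm he hp hφ.contMDiffAt).differentiableAt (by simp)) i
  simp only [coordKappa, hpd, Finset.mul_sum]
  refine Finset.sum_congr rfl fun i _ => Finset.sum_congr rfl fun j _ => ?_
  ring

theorem IsEigenfunction.const_mul (hφ : IsEigenfunction g lam mu φ) (a : ℂ) :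
    IsEigenfunction g lam mu (fun x => a * φ x) where
  contMDiff := (ContinuousLinearMap.mul ℝ ℂ a).contDiff.contMDiff.comp hφ.contMDiff
  laplacian e he x hx := by
    rw [coordLaplacian_const_mul he (e.map_source hx) hφ.contMDiff, hφ.laplacian e he x hx,
      mul_left_comm]
  kappa e he x hx := by
    rw [coordKappa_const_mul he (e.map_source hx) hφ.contMDiff, hφ.kappa e he x hx,
      mul_left_comm, ← mul_pow]

theorem isEigenfunction_div_const_iff {a : ℂ} (ha : a ≠ 0) :
    IsEigenfunction g lam mu (fun x => φ x / a) ↔ IsEigenfunction g lam mu φ := by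
  simp only [div_eq_inv_mul]
  exact ⟨fun h => by simpa [ha] using h.const_mul a, fun h => h.const_mul a⁻¹⟩

theorem exists_circle_coe_eq_div {X : Type*} {φ : X → ℂ} {r : ℝ} (hr : r ≠ 0)
    (hφ : ∀ x, ‖φ x‖ = r) : ∃ π : X → Circle, ∀ x, (π x : ℂ) = φ x / r := by
  refine ⟨fun x => ⟨φ x / r, mem_sphere_zero_iff_norm.2 ?_⟩, fun x => rfl⟩
  rw [← hφ x, norm_div, Complex.norm_real, norm_norm, hφ x, div_self hr]

theorem isEigenfunction_iff_of_circle_coe_eq_div [CompactSpace M] [Nonempty M] {lam : ℝ} {a : ℂ}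
    {π : M → Circle} (ha : a ≠ 0) (hπ : ∀ x, (π x : ℂ) = φ x / a) {c : ℝ} (hc : 0 < c)
    (hlam : c * lam = -1) :
    IsEigenfunction g (lam : ℂ) (lam : ℂ) φ ↔
      IsHarmonicMap g (circleMetric c hc) π ∧ IsRiemannianSubmersion g (circleMetric c hc) π := by
  rw [← isEigenfunction_div_const_iff ha, ← funext hπ]
  exact isEigenfunction_circle_iff_isHarmonicMap_and_isRiemannianSubmersion g hc hlam

end Normalization

end LLEigen

end

theorem theorem1p1_general {m : ℕ} {M : Type*} [TopologicalSpace M] [CompactSpace M]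
    [ConnectedSpace M] [ChartedSpace (EuclideanSpace ℝ (Fin m)) M] [IsManifold (𝓡 m) ∞ M]
    (g : LLEigen.Metric m M) (lam : ℝ) (hlam : lam < 0) (φ : M → ℂ) (hne : ∃ x, φ x ≠ 0) :
    LLEigen.IsEigenfunction g (lam : ℂ) (lam : ℂ) φ ↔
      ∀ x₀ : M, φ x₀ ≠ 0 ∧ ∃ π : M → Circle,
        (∀ x, (π x : ℂ) = φ x / (‖φ x₀‖ : ℂ)) ∧
        LLEigen.IsHarmonicMap g
          (LLEigen.circleMetric (1 / |lam|) (one_div_pos.2 (abs_pos.2 hlam.ne))) π ∧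
        LLEigen.IsRiemannianSubmersion g
          (LLEigen.circleMetric (1 / |lam|) (one_div_pos.2 (abs_pos.2 hlam.ne))) π := by
  obtain ⟨y, hy⟩ := hne
  have : Nonempty M := ⟨y⟩
  have hc : 1 / |lam| * lam = -1 := by
    rw [abs_of_neg hlam, one_div_neg_eq_neg_one_div, neg_mul, one_div_mul_cancel hlam.ne]
  have hnorm {x₀ : M} (hx₀ : φ x₀ ≠ 0) : (‖φ x₀‖ : ℂ) ≠ 0 :=
    Complex.ofReal_ne_zero.2 (norm_ne_zero_iff.2 hx₀)
  constructor
  · intro h x₀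
    have hx₀ : φ x₀ ≠ 0 := norm_ne_zero_iff.1 (h.norm_eq y x₀ ▸ norm_ne_zero_iff.2 hy)
    obtain ⟨π, hπ⟩ := LLEigen.exists_circle_coe_eq_div (norm_ne_zero_iff.2 hx₀) (h.norm_eq · x₀)
    exact ⟨hx₀, π, hπ,
      (LLEigen.isEigenfunction_iff_of_circle_coe_eq_div (hnorm hx₀) hπ _ hc).1 h⟩
  · intro h
    obtain ⟨hy, π, hπ, hharm_sub⟩ := h y
    exact (LLEigen.isEigenfunction_iff_of_circle_coe_eq_div (hnorm hy) hπ _ hc).2 hharm_sub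

theorem theorem1p1 {m : ℕ} {M : Type*} [TopologicalSpace M] [T2Space M] [CompactSpace M]
    [ConnectedSpace M] [ChartedSpace (EuclideanSpace ℝ (Fin m)) M] [IsManifold (𝓡 m) ∞ M]
    (g : LLEigen.Metric m M) (lam : ℝ) (hlam : lam < 0) (φ : M → ℂ)
    (hφ : ContMDiff (𝓡 m) 𝓘(ℝ, ℂ) ∞ φ) (hconst : ¬ ∃ c, ∀ x, φ x = c) :
    LLEigen.IsEigenfunction g (lam : ℂ) (lam : ℂ) φ ↔
      ∀ x₀ : M, φ x₀ ≠ 0 ∧ ∃ π : M → Circle,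
        (∀ x, (π x : ℂ) = φ x / (‖φ x₀‖ : ℂ)) ∧
        LLEigen.IsHarmonicMap g
          (LLEigen.circleMetric (1 / |lam|) (one_div_pos.2 (abs_pos.2 hlam.ne))) π ∧
        LLEigen.IsRiemannianSubmersion g
          (LLEigen.circleMetric (1 / |lam|) (one_div_pos.2 (abs_pos.2 hlam.ne))) π :=
  theorem1p1_general g lam hlam φ (by_contra fun h => hconst ⟨0, not_exists_not.1 h⟩)
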